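/- **Setting.** Let $\mathfrak g$ be a simple finite-dimensional complex Lie algebra, $\mathfrak h$ a Cartan subalgebra, $\Omega\subset\mathfrak h^*$ the root system, $\Pi$ a base of $\Omega$, $\Omega^+$ the positive roots. Choose root vectors $E_\alpha\in\mathfrak g_\alpha$ with $(E_\alpha,E_{-\alpha})=1$ for the Killing form. For $\Gamma\subset\Pi$ let $\mathfrak h^*_\Gamma$ be the span of $\Gamma$, $\Omega_\Gamma=\Omega\cap\mathfrak h^*_\Gamma$, $\mathfrak g_\Gamma$ the Levi subalgebra generated by $\mathfrak h$ and the $E_{\pm\alpha}$ ($\alpha\in\Gamma$), and $\mathfrak m$ its invariant complement, spanned by the $E_\gamma$, $\gamma\in\Omega\setminus\Omega_\Gamma$. The *quasiroots* are the nonzero images of the roots in $\mathfrak h^*/\mathfrak h^*_\Gamma$. Let $\lambda\in\mathfrak g^*$ have coadjoint stabilizer $\mathfrak g_\Gamma$; its orbit $M\cong G/G_\Gamma$ is a semisimple orbit, and every semisimple orbit arises so for a suitable $\Gamma$. As usual, the $G$-invariant polyvector fields on $M$ are identified with the $\mathfrak g_\Gamma$-invariant elements of $\Lambda^\bullet\mathfrak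 m\cong\Lambda^\bullet(\mathfrak g/\mathfrak g_\Gamma)$. An *invariant bracket* on $M$ is a $\mathfrak g_\Gamma$-invariant element $f\in\Lambda^2\mathfrak m$. The Schouten bracket of two invariant brackets is the image in $\Lambda^3(\mathfrak g/\mathfrak g_\Gamma)$ of their bracket in $\Lambda^3\mathfrak g$, where $$[\![X_1\wedge X_2,Y_1\wedge Y_2]\!]=\sum_{i,j}(-1)^{i+j}[X_i,Y_j]\wedge X_{3-i}\wedge Y_{3-j}.$$ Let $r=\sum_{\alpha\in\Omega^+}E_\alpha\wedge E_{-\alpha}$, let $\varphi=[\![r,r]\!]$, which is an invariant element of $\Lambda^3\mathfrak g$, and let $\varphi_M$ be its image in $\Lambda^3(\mathfrak g/\mathfrak g_\Gamma)$. The Kirillov–Kostant–Souriau bracket of the orbit is $$v_\lambda=\sum_{\alpha\in\Omega^+\setminus\Omega_\Gamma}\frac1{\lambda([E_\alpha,E_{-\alpha}])}\,E_\alpha\wedge E_{-\alpha}.$$ The orbit $M$ is called *good* if there is an invariant bracket $f$ on $M$ with $[\![f,f]\!]=K^2\varphi_M$ for some complex number $K\neq0$ and $[\![f,v_\lambda]\!]=0$.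 **Proposition 3.5.** (a) If $\mathfrak g$ is of type $A_n$, then every semisimple orbit is good. (b) If $\mathfrak g$ is not of type $A_n$ and $M$ is not a point ($\Gamma\ne\Pi$), then $M$ is good if and only if $\Pi\setminus\Gamma$ consists of one or two simple roots, each of which occurs with coefficient $1$ in the maximal root. (c) For every $\mathfrak g$, $M$ is good if and only if for some $k\ge0$ the set of quasiroots is linearly isomorphic to the root system of type $A_k$ (the empty set for $k=0$, which occurs exactly when $M$ is a point). -/

import Mathlib

open scoped ExteriorAlgebra

noncomputable section

namespace GoodOrbit

open Module LieAlgebra LieAlgebra.IsKilling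

/-! ### Bivectors over a Lie algebra and their Schouten bracket -/

section Schouten

variable {L : Type*} [LieRing L] [LieAlgebra ℂ L]

/-- The bivector `x ∧ y` in `⋀² L`. -/
def wedge (x y : L) : ⋀[ℂ]^2 L := exteriorPower.ιMulti ℂ 2 ![x, y]

/-- The product `x ∧ y` in the exterior algebra, as a bilinear map. -/
def wedgeAlg : L →ₗ[ℂ] L →ₗ[ℂ] ExteriorAlgebra ℂ L :=
  (LinearMap.mul ℂ (ExteriorAlgebra ℂ L)).compl₁₂ (ExteriorAlgebra.ι ℂ) (ExteriorAlgebra.ι ℂ)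

/-- Universal property of `⋀²`: an alternating bilinear map factors through `⋀² L`. -/
def altLift {N : Type*} [AddCommGroup N] [Module ℂ N] (B : L →ₗ[ℂ] L →ₗ[ℂ] N)
    (hB : ∀ x, B x x = 0) : ⋀[ℂ]^2 L →ₗ[ℂ] N :=
  exteriorPower.alternatingMapLinearEquiv
    { toFun := fun v => B (v 0) (v 1)
      map_update_add' := by
        intro _ m i x y
        fin_cases i <;> simp [Function.update]
      map_update_smul' := by
        intro _ m i c x
        fin_cases i <;> simp [Function.update]
      map_eq_zero_of_eq' := by
        intro v i j hij hne
        fin_cases i <;> fin_cases j <;> simp_all }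

theorem altLift_wedge {N : Type*} [AddCommGroup N] [Module ℂ N] (B : L →ₗ[ℂ] L →ₗ[ℂ] N)
    (hB : ∀ x, B x x = 0) (x y : L) : altLift B hB (wedge x y) = B x y := by
  simp [altLift, wedge]

/-- The adjoint action of `x` on bivectors, `x · (y ∧ z) = [x, y] ∧ z + y ∧ [x, z]`. -/
def adBivector (x : L) : ⋀[ℂ]^2 L →ₗ[ℂ] ExteriorAlgebra ℂ L :=
  altLift (wedgeAlg.compl₁₂ (LieAlgebra.ad ℂ L x : L →ₗ[ℂ] L) LinearMap.id
      + wedgeAlg.compl₁₂ LinearMap.id (LieAlgebra.ad ℂ L x : L →ₗ[ℂ] L)) (by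
    intro y
    simp [wedgeAlg, ExteriorAlgebra.ι_add_mul_swap])

theorem adBivector_wedge (x y z : L) :
    adBivector x (wedge y z) = ExteriorAlgebra.ι ℂ ⁅x, y⁆ * ExteriorAlgebra.ι ℂ z
      + ExteriorAlgebra.ι ℂ y * ExteriorAlgebra.ι ℂ ⁅x, z⁆ := by
  simp [adBivector, altLift_wedge, wedgeAlg]

theorem bivector_hom_ext {N : Type*} [AddCommGroup N] [Module ℂ N] {f g : ⋀[ℂ]^2 L →ₗ[ℂ] N}
    (h : ∀ x y, f (wedge x y) = g (wedge x y)) : f = g := by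
  apply exteriorPower.linearMap_ext
  ext v
  have hv : v = ![v 0, v 1] := by
    ext i
    fin_cases i <;> rfl
  rw [hv]
  exact h (v 0) (v 1)

/-- The bilinear map sending `(x, y)` to `w ↦ x ∧ (y · w) - y ∧ (x · w)`. -/
def wedgeAd : L →ₗ[ℂ] L →ₗ[ℂ] (⋀[ℂ]^2 L →ₗ[ℂ] ExteriorAlgebra ℂ L) :=
  LinearMap.mk₂ ℂ
    (fun x y => (LinearMap.mulLeft ℂ (ExteriorAlgebra.ι ℂ x)).comp (adBivector y)
      - (LinearMap.mulLeft ℂ (ExteriorAlgebra.ι ℂ y)).comp (adBivector x))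
    (by
      intro x x' y
      apply bivector_hom_ext
      intro u v
      simp only [LinearMap.comp_apply, LinearMap.add_apply, LinearMap.sub_apply, adBivector_wedge,
        add_lie, map_add, LinearMap.mulLeft_apply, mul_add, add_mul]
      abel)
    (by
      intro c x y
      apply bivector_hom_ext
      intro u v
      simp only [LinearMap.comp_apply, LinearMap.smul_apply, LinearMap.sub_apply, adBivector_wedge,
        smul_lie, map_smul, LinearMap.mulLeft_apply, mul_add, smul_mul_assoc, mul_smul_comm,
        smul_add, smul_sub])
    (by
      intro x y y'
      apply bivector_hom_ext
      intro u v
      simp only [LinearMap.comp_apply, LinearMap.add_apply, LinearMap.sub_apply, adBivector_wedge,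
        add_lie, map_add, LinearMap.mulLeft_apply, mul_add, add_mul]
      abel)
    (by
      intro c x y
      apply bivector_hom_ext
      intro u v
      simp only [LinearMap.comp_apply, LinearMap.smul_apply, LinearMap.sub_apply, adBivector_wedge,
        smul_lie, map_smul, LinearMap.mulLeft_apply, mul_add, smul_mul_assoc, mul_smul_comm,
        smul_add, smul_sub])

/-- The Schouten bracket of two bivectors over `L`; it is a trivector, viewed in the exterior
algebra. Its usual formula is `schouten_wedge` below. -/
def schouten : ⋀[ℂ]^2 L →ₗ[ℂ] ⋀[ℂ]^2 L →ₗ[ℂ] ExteriorAlgebra ℂ L :=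
  altLift wedgeAd (by
    intro x
    simp [wedgeAd])

/-- The formula `⟦X₁ ∧ X₂, Y₁ ∧ Y₂⟧ = ∑ (-1)^(i+j) [Xᵢ, Yⱼ] ∧ (the other X) ∧ (the other Y)`,
which determines the Schouten bracket of bivectors. -/
theorem schouten_wedge (x₁ x₂ y₁ y₂ : L) :
    schouten (wedge x₁ x₂) (wedge y₁ y₂) =
      ExteriorAlgebra.ι ℂ ⁅x₁, y₁⁆ * ExteriorAlgebra.ι ℂ x₂ * ExteriorAlgebra.ι ℂ y₂
      - ExteriorAlgebra.ι ℂ ⁅x₁, y₂⁆ * ExteriorAlgebra.ι ℂ x₂ * ExteriorAlgebra.ι ℂ y₁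
      - ExteriorAlgebra.ι ℂ ⁅x₂, y₁⁆ * ExteriorAlgebra.ι ℂ x₁ * ExteriorAlgebra.ι ℂ y₂
      + ExteriorAlgebra.ι ℂ ⁅x₂, y₂⁆ * ExteriorAlgebra.ι ℂ x₁ * ExteriorAlgebra.ι ℂ y₁ := by
  have swap : ∀ a c : L, ExteriorAlgebra.ι ℂ a * ExteriorAlgebra.ι ℂ c
      = -(ExteriorAlgebra.ι ℂ c * ExteriorAlgebra.ι ℂ a) := fun a c =>
    eq_neg_of_add_eq_zero_left (ExteriorAlgebra.ι_add_mul_swap a c)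
  have key : schouten (wedge x₁ x₂) (wedge y₁ y₂) =
      ExteriorAlgebra.ι ℂ x₁ * (ExteriorAlgebra.ι ℂ ⁅x₂, y₁⁆ * ExteriorAlgebra.ι ℂ y₂
        + ExteriorAlgebra.ι ℂ y₁ * ExteriorAlgebra.ι ℂ ⁅x₂, y₂⁆)
      - ExteriorAlgebra.ι ℂ x₂ * (ExteriorAlgebra.ι ℂ ⁅x₁, y₁⁆ * ExteriorAlgebra.ι ℂ y₂
        + ExteriorAlgebra.ι ℂ y₁ * ExteriorAlgebra.ι ℂ ⁅x₁, y₂⁆) := by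
    rw [schouten, altLift_wedge]
    simp [wedgeAd, adBivector_wedge]
  rw [key, swap y₁ ⁅x₂, y₂⁆, swap y₁ ⁅x₁, y₂⁆, mul_add, mul_add, mul_neg, mul_neg,
    ← mul_assoc, ← mul_assoc, ← mul_assoc, ← mul_assoc, swap x₁ ⁅x₂, y₁⁆, swap x₁ ⁅x₂, y₂⁆,
    swap x₂ ⁅x₁, y₁⁆, swap x₂ ⁅x₁, y₂⁆]
  simp only [neg_mul]
  abel

/-- The stabilizer of `lam ∈ L*` under the coadjoint action `(x · lam) y = -lam [x, y]`. -/
def coadjointStabilizer (lam : Dual ℂ L) : LieSubalgebra ℂ L where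
  carrier := {x | ∀ y, lam ⁅x, y⁆ = 0}
  add_mem' := by
    intro x x' hx hx' y
    simp [hx y, hx' y]
  zero_mem' := by
    intro y
    simp
  smul_mem' := by
    intro c x hx y
    simp [hx y]
  lie_mem' := by
    intro x x' hx hx' y
    rw [lie_lie, map_sub, hx, hx', sub_zero]

end Schouten

/-! ### Root vectors, Levi subalgebras and invariant bivectors -/

section Orbit

variable {L : Type*} [LieRing L] [LieAlgebra ℂ L] [FiniteDimensional ℂ L] [LieAlgebra.IsKilling ℂ L]
  {H : LieSubalgebra ℂ L} [H.IsCartanSubalgebra]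

variable (H) in
/-- A choice of root vectors `E_α`, normalized by `(E_α, E_{-α}) = 1` for the Killing form.
(The value of `vec` at the zero weight is irrelevant.) -/
structure RootVectors where
  vec : LieModule.Weight ℂ H L → L
  mem_rootSpace : ∀ α ∈ H.root, vec α ∈ LieAlgebra.rootSpace H α
  killing_eq_one : ∀ α ∈ H.root, killingForm ℂ L (vec α) (vec (-α)) = 1

/-- The subspace `h*_Γ` of `h*` generated by a set `Γ` of roots. -/
def rootSpan (Γ : Finset H.root) : Submodule ℂ (Dual ℂ H) :=
  Submodule.span ℂ ((rootSystem H).root '' (Γ : Set H.root))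

/-- The root subsystem `Ω_Γ = Ω ∩ h*_Γ`. -/
def leviRoots (Γ : Finset H.root) : Set H.root :=
  {α | (rootSystem H).root α ∈ rootSpan Γ}

/-- The Levi subalgebra `g_Γ`, generated by `h` and the `E_α`, `E_{-α}` with `α ∈ Γ`. -/
def levi (E : RootVectors H) (Γ : Finset H.root) : LieSubalgebra ℂ L :=
  LieSubalgebra.lieSpan ℂ L
    ((H : Set L) ∪ {x | ∃ α ∈ Γ, x = E.vec α.1 ∨ x = E.vec (-α.1)})

/-- The `ad g_Γ`-invariant complement `m` of `g_Γ`, with basis the `E_γ`, `γ ∈ Ω \ Ω_Γ`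
(`γ` positive or negative). -/
def tangent (E : RootVectors H) (Γ : Finset H.root) : Submodule ℂ L :=
  Submodule.span ℂ {x | ∃ γ : H.root, γ ∉ leviRoots Γ ∧ x = E.vec γ.1}

/-- `f` is a `g_Γ`-invariant element of `⋀² m`: such elements are the invariant brackets
(invariant bivector fields) on `M = G / G_Γ`. -/
def IsInvariantBracket (E : RootVectors H) (Γ : Finset H.root) (f : ⋀[ℂ]^2 L) : Prop :=
  f ∈ Submodule.span ℂ {w | ∃ x ∈ tangent E Γ, ∃ y ∈ tangent E Γ, w = wedge x y} ∧
    ∀ x ∈ levi E Γ, adBivector x f = 0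

/-- Reduction modulo `g_Γ ∧ ⋀ L`, that is, the map `⋀ L → ⋀ (L / g_Γ) = ⋀ T_o M` sending a
polyvector over `L` to the value at the base point `o` of the field that it induces on `M`. -/
def toM (E : RootVectors H) (Γ : Finset H.root) :
    ExteriorAlgebra ℂ L →ₐ[ℂ] ExteriorAlgebra ℂ (L ⧸ (levi E Γ).toSubmodule) :=
  ExteriorAlgebra.map (levi E Γ).toSubmodule.mkQ

open Classical in
/-- The Drinfeld-Jimbo `r`-matrix `r = ∑_{α > 0} E_α ∧ E_{-α}`. -/
def rMatrix (b : (rootSystem H).Base) (E : RootVectors H) : ⋀[ℂ]^2 L :=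
  ∑ α : H.root with b.IsPos α, wedge (E.vec α.1) (E.vec (-α.1))

/-- The invariant trivector `φ = ⟦r, r⟧`. -/
def phi (b : (rootSystem H).Base) (E : RootVectors H) : ExteriorAlgebra ℂ L :=
  schouten (rMatrix b E) (rMatrix b E)

open Classical in
/-- The Kirillov-Kostant-Souriau bracket `v_lam = ∑ (1 / lam(α)) E_α ∧ E_{-α}`, summed over the
positive roots outside `Ω_Γ`. Here `lam(α) = lam [E_α, E_{-α}]`, as `[E_α, E_{-α}] ∈ h` is the
element corresponding to `α` under the Killing form; the denominators do not vanish when the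
stabilizer of `lam` is `g_Γ`. -/
def kks (b : (rootSystem H).Base) (E : RootVectors H) (Γ : Finset H.root) (lam : Dual ℂ L) :
    ⋀[ℂ]^2 L :=
  ∑ α : H.root with b.IsPos α ∧ α ∉ leviRoots Γ,
    (lam ⁅E.vec α.1, E.vec (-α.1)⁆)⁻¹ • wedge (E.vec α.1) (E.vec (-α.1))

/-- The orbit `M` of `lam` (with stabilizer `g_Γ`) is good: it carries an invariant bracket `f`
with `⟦f, f⟧ = K² φ_M` for some `K ≠ 0` and `⟦f, v_lam⟧ = 0`. -/
def IsGood (b : (rootSystem H).Base) (E : RootVectors H) (Γ : Finset H.root)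
    (lam : Dual ℂ L) : Prop :=
  ∃ f : ⋀[ℂ]^2 L, IsInvariantBracket E Γ f ∧
    (∃ K : ℂ, K ≠ 0 ∧ toM E Γ (schouten f f) = K ^ 2 • toM E Γ (phi b E)) ∧
    toM E Γ (schouten f (kks b E Γ lam)) = 0

/-- The simple roots can be numbered so that the Cartan matrix is that of type `A_n`. -/
def IsTypeA (b : (rootSystem H).Base) : Prop :=
  ∃ (n : ℕ) (e : b.support ≃ Fin n), ∀ i j, b.cartanMatrix i j = CartanMatrix.A n (e i) (e j)

/-- `θ` is the maximal root: `θ - β` is a sum of simple roots for every root `β`. -/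
def IsMaximalRoot (b : (rootSystem H).Base) (θ : H.root) : Prop :=
  ∀ β : H.root, (rootSystem H).root θ - (rootSystem H).root β ∈
    AddSubmonoid.closure ((rootSystem H).root '' (b.support : Set H.root))

/-- The quasiroots: the nonzero images of the roots in `h* / h*_Γ`. -/
def quasiroots (Γ : Finset H.root) : Set (Dual ℂ H ⧸ rootSpan Γ) :=
  {q | q ≠ 0 ∧ ∃ α : H.root, q = (rootSpan Γ).mkQ ((rootSystem H).root α)}

end Orbit

/-- The roots `e_i - e_j`, `i ≠ j`, of the root system of type `A_k` in `ℂ^(k+1)`. -/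
def rootsA (k : ℕ) : Set (Fin (k + 1) → ℂ) :=
  {v | ∃ i j, i ≠ j ∧ v = Pi.single i 1 - Pi.single j 1}

/-- A subset `S` of a vector space is isomorphic to the root system of type `A_k`: some linear
isomorphism onto the span of the roots of `A_k` maps `S` onto these roots. -/
def IsIsoToRootsA {V : Type*} [AddCommGroup V] [Module ℂ V] (S : Set V) (k : ℕ) : Prop :=
  ∃ e : V ≃ₗ[ℂ] Submodule.span ℂ (rootsA k),
    (fun v => (e v : Fin (k + 1) → ℂ)) '' S = rootsA k

end GoodOrbit

end

/-!
A bivector `f` on `m` that is invariant under the Cartan subalgebra acts on `L`, through the Killing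
form, by a scalar `s α` on each root vector `E_α`. Goodness of the orbit becomes a condition on the
`s α`, and for `m α = l(α)² s α`, where `l` is the functional on `h*` given by `λ`, one of the two
brackets says that `m` is additive on the roots, hence linear, and the other becomes
`(m(β) l(α) - m(α) l(β))² = (l(α) l(β) l(α + β))²`.

Dividing `m` by `l` and combining with `l` turns each root outside the Levi subsystem into an arrow
`S α → T α` between points of `ℂ`, with `T α - S α = l(α)` and `T α + S α = m(α) / l(α)`, and makes
sums of roots into compositions of arrows. As the root system is irreducible, the arrows form a
complete digraph on `k + 1` points, which identifies the quasiroots with the roots of `A_k`.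
Conversely, if each root outside the Levi subsystem joins two points of `ℂ` with difference `l(α)`,
then `m(α) = (T α)² - (S α)²` satisfies both conditions.
-/

namespace GoodOrbit

section RootSystems

open Module RootPairing

variable {ι K M N : Type*} [Field K] [CharZero K] [AddCommGroup M] [Module K M] [AddCommGroup N]
  [Module K N] [Finite ι] {P : RootPairing ι K M N} [P.IsCrystallographic]

theorem exists_dual_of_additive [P.IsRootSystem] (b : P.Base) (g : ι → K)
    (hneg : ∀ i, g (P.reflectionPerm i i) = -g i)
    (hadd : ∀ i j k, P.root k = P.root i + P.root j → g k = g i + g j) :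
    ∃ φ : Dual K M, ∀ i, φ (P.root i) = g i := by
  let φ : Dual K M := b.toWeightBasis.constr K fun i => g i
  have hφ : ∀ i ∈ b.support, φ (P.root i) = g i := fun i hi => by
    have := b.toWeightBasis.constr_basis K (fun i : b.support => g i) ⟨i, hi⟩
    rwa [b.toWeightBasis_apply] at this
  refine ⟨φ, fun i => b.induction_add (p := fun i => φ (P.root i) = g i) i ?_ hφ ?_⟩
  · intro i hi
    rw [hneg, ← hi]
    simp
  · intro i j k hk hi hj
    rw [hk, map_add, hi, hφ j hj, hadd i j k hk]

theorem pairingIn_eq_zero_of_forall_or {f g : Dual K M}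
    (h : ∀ i, f (P.root i) = 0 ∨ g (P.root i) = 0) {i j : ι} (hi : f (P.root i) ≠ 0)
    (hj : g (P.root j) ≠ 0) : P.pairingIn ℤ i j = 0 := by
  have gi := (h i).resolve_left hi
  have fj := (h j).resolve_right hj
  rcases lt_trichotomy (P.pairingIn ℤ i j) 0 with hlt | h0 | hgt
  · obtain ⟨k, hk⟩ := P.root_add_root_mem_of_pairingIn_neg hlt fun e => hi (by simp [e, fj])
    simpa [hk, gi, fj, hi, hj] using h k
  · exact h0
  · obtain ⟨k, hk⟩ := P.root_sub_root_mem_of_pairingIn_pos hgt fun e => hi (e ▸ fj)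
    simpa [hk, gi, fj, hi, hj] using h k

/-- Otherwise the span of the roots on which `f` does not vanish would be invariant under all
reflections and orthogonal to the roots on which `g` does not vanish. -/
theorem exists_root_apply_ne_zero_and [P.IsIrreducible] {f g : Dual K M}
    (hf : ∃ i, f (P.root i) ≠ 0) (hg : ∃ i, g (P.root i) ≠ 0) :
    ∃ i, f (P.root i) ≠ 0 ∧ g (P.root i) ≠ 0 := by
  by_contra! hcon
  have hperp : ∀ i j, f (P.root i) ≠ 0 → g (P.root j) ≠ 0 → P.pairing i j = 0 :=
    fun i j hi hj => by
      have h : ∀ i, f (P.root i) = 0 ∨ g (P.root i) = 0 := fun i => or_iff_not_imp_left.2 (hcon i)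
      rw [← P.algebraMap_pairingIn ℤ, pairingIn_eq_zero_of_forall_or h hi hj, map_zero]
  let q : Submodule K M := Submodule.span K (P.root '' {i | f (P.root i) ≠ 0})
  have hmem : ∀ i, f (P.root i) ≠ 0 → P.root i ∈ q := fun i hi =>
    Submodule.subset_span ⟨i, hi, rfl⟩
  have hinv : ∀ j, q ∈ Module.End.invtSubmodule (P.reflection j) := by
    intro j
    rw [Module.End.mem_invtSubmodule, Submodule.span_le]
    rintro _ ⟨i, hi, rfl⟩
    change P.reflection j (P.root i) ∈ q
    by_cases hfj : f (P.root j) = 0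
    · by_cases hgj : g (P.root j) = 0
      · rw [← P.root_reflectionPerm]
        refine hmem _ ?_
        rwa [P.root_reflectionPerm, P.reflection_apply_root, map_sub, map_smul, hfj, smul_zero,
          sub_zero]
      · rw [P.reflection_apply_root, hperp i j hi hgj, zero_smul, sub_zero]
        exact hmem i hi
    · rw [P.reflection_apply_root]
      exact q.sub_mem (hmem i hi) (q.smul_mem _ (hmem j hfj))
  obtain ⟨i, hi⟩ := hf
  obtain ⟨j, hj⟩ := hg
  have htop : q = ⊤ := IsIrreducible.eq_top_of_invtSubmodule_reflection q hinv
    (q.ne_bot_iff.mpr ⟨_, hmem i hi, P.ne_zero i⟩)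
  have hle : q ≤ LinearMap.ker (P.coroot' j) := by
    rw [Submodule.span_le]
    rintro _ ⟨i, hi, rfl⟩
    simpa using hperp i j hi hj
  have : P.root j ∈ LinearMap.ker (P.coroot' j) := hle (htop ▸ Submodule.mem_top)
  simp at this

end RootSystems

section Arrows

open Module RootPairing

variable {ι K M N : Type*} [Field K] [AddCommGroup M] [Module K M] [AddCommGroup N] [Module K N]
  {V : Type*} [DecidableEq V]

variable (K V) in
/-- The roots of type `A` with set of coordinates `V`. -/
def arrows : Set (V → K) := {v | ∃ i j, i ≠ j ∧ v = Pi.single i 1 - Pi.single j 1}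

variable (V) in
/-- A labelling of the roots by arrows `src i ⟶ tgt i` between points of `V` such that
`i ↦ [tgt i] - [src i]` extends to a linear map which kills `Q`, and such that the roots in `Q` are
those with a trivial arrow. -/
structure ArrowLabelling (P : RootPairing ι K M N) (Q : Submodule K M) where
  src : ι → V
  tgt : ι → V
  toLin : M →ₗ[K] (V → K)
  toLin_root : ∀ i, toLin (P.root i) = Pi.single (tgt i) 1 - Pi.single (src i) 1
  root_mem_iff : ∀ i, P.root i ∈ Q ↔ tgt i = src i
  le_ker : Q ≤ LinearMap.ker toLin

namespace ArrowLabelling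

variable {P : RootPairing ι K M N} {Q : Submodule K M} (A : ArrowLabelling V P Q)

/-- The coordinates of `[tgt i] - [src i]`, as integers. -/
def deg (i : ι) (v : V) : ℤ := (if v = A.tgt i then 1 else 0) - (if v = A.src i then 1 else 0)

/-- Every nontrivial arrow between points of `V` is the arrow of a root. -/
def IsFull : Prop := ∀ u v, u ≠ v → ∃ i, A.tgt i = u ∧ A.src i = v

theorem cast_deg (i : ι) (v : V) : (A.deg i v : K) = A.toLin (P.root i) v := by
  simp [toLin_root, deg, Pi.single_apply]

theorem root_notMem_iff {i : ι} : P.root i ∉ Q ↔ A.tgt i ≠ A.src i :=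
  (A.root_mem_iff i).not

variable [CharZero K]

theorem toLin_root_apply_ne_zero_iff {i : ι} {v : V} :
    A.toLin (P.root i) v ≠ 0 ↔ P.root i ∉ Q ∧ (v = A.tgt i ∨ v = A.src i) := by
  rw [← cast_deg, Int.cast_ne_zero, A.root_notMem_iff, deg]
  grind

theorem ends_eq_of_sub_mem {i j : ι} (h : P.root i - P.root j ∈ Q) (hi : P.root i ∉ Q) :
    A.tgt i = A.tgt j ∧ A.src i = A.src j := by
  have hdeg : ∀ v, A.deg i v = A.deg j v := fun v => by
    apply Int.cast_injective (α := K)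
    have := LinearMap.mem_ker.1 (A.le_ker h)
    rw [map_sub, sub_eq_zero] at this
    simp [cast_deg, this]
  rw [A.root_notMem_iff] at hi
  have h₁ := hdeg (A.tgt i)
  have h₂ := hdeg (A.src i)
  simp only [deg] at h₁ h₂
  grind

theorem ends_of_root_eq_neg {i j : ι} (h : P.root j = -P.root i) (hi : P.root i ∉ Q) :
    A.tgt j = A.src i ∧ A.src j = A.tgt i := by
  have hdeg : ∀ v, A.deg j v = -A.deg i v := fun v => by
    apply Int.cast_injective (α := K)
    simp [cast_deg, h]
  rw [A.root_notMem_iff] at hi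
  have h₁ := hdeg (A.tgt i)
  have h₂ := hdeg (A.src i)
  simp only [deg] at h₁ h₂
  grind

theorem ends_of_root_eq_add {i j k : ι} (h : P.root k = P.root i + P.root j) (hi : P.root i ∉ Q)
    (hj : P.root j ∉ Q) (hk : P.root k ∉ Q) :
    (A.src i = A.tgt j ∧ A.tgt k = A.tgt i ∧ A.src k = A.src j) ∨
      (A.src j = A.tgt i ∧ A.tgt k = A.tgt j ∧ A.src k = A.src i) := by
  rw [A.root_notMem_iff] at hi hj hk
  have hdeg : ∀ v, A.deg k v = A.deg i v + A.deg j v := fun v => by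
    apply Int.cast_injective (α := K)
    simp [cast_deg, h]
  have h₁ := hdeg (A.tgt i)
  have h₂ := hdeg (A.src i)
  have h₃ := hdeg (A.tgt j)
  have h₄ := hdeg (A.src j)
  have h₅ := hdeg (A.tgt k)
  simp only [deg] at h₁ h₂ h₃ h₄ h₅
  grind

theorem tgt_eq_src_or_of_root_eq_add {i j k : ι} (h : P.root k = P.root i + P.root j)
    (hi : P.root i ∉ Q) (hj : P.root j ∉ Q) :
    (A.tgt i = A.src j ∨ A.tgt j = A.src i) ∧ A.tgt i ≠ A.tgt j ∧ A.src i ≠ A.src j := by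
  by_cases hk : P.root k ∈ Q
  · have hij : P.root i - -P.root j ∈ Q := by simpa [h] using hk
    have : P.root (P.reflectionPerm j j) = -P.root j := by simp
    have hj' := A.ends_of_root_eq_neg this hj
    rw [← this] at hij
    have hi' := A.ends_eq_of_sub_mem hij hi
    rw [A.root_notMem_iff] at hi hj
    grind
  · have := A.ends_of_root_eq_add h hi hj hk
    rw [A.root_notMem_iff] at hi hj hk
    grind

variable [Finite ι] [P.IsCrystallographic]

theorem ends_of_pairingIn_neg {i j : ι} (hi : P.root i ∉ Q) (hj : P.root j ∉ Q)
    (h : P.pairingIn ℤ i j < 0) :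
    (A.tgt i = A.src j ∨ A.tgt j = A.src i) ∧ A.tgt i ≠ A.tgt j ∧ A.src i ≠ A.src j := by
  by_cases hij : P.root i = -P.root j
  · have := A.ends_of_root_eq_neg hij hj
    rw [A.root_notMem_iff] at hi
    grind
  · obtain ⟨k, hk⟩ := P.root_add_root_mem_of_pairingIn_neg h hij
    exact A.tgt_eq_src_or_of_root_eq_add hk hi hj

theorem ends_of_pairingIn_pos {i j : ι} (hi : P.root i ∉ Q) (hj : P.root j ∉ Q)
    (h : 0 < P.pairingIn ℤ i j) :
    (A.tgt i = A.tgt j ∨ A.src i = A.src j) ∧ A.tgt i ≠ A.src j ∧ A.src i ≠ A.tgt j := by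
  have hj' := A.ends_of_root_eq_neg (j := P.reflectionPerm j j) (by simp) hj
  have := A.ends_of_pairingIn_neg (j := P.reflectionPerm j j) hi (by simpa using hj) (by simpa)
  grind

include A in
theorem sub_mem_of_pairingIn_ne_zero {i j : ι} (ht : A.tgt i = A.tgt j) (hs : A.src i = A.src j)
    (hi : P.root i ∉ Q) (h : P.pairingIn ℤ i j ≠ 0) : P.root i - P.root j ∈ Q := by
  have hj : P.root j ∉ Q := by rwa [A.root_notMem_iff, ← ht, ← hs, ← A.root_notMem_iff]
  have hpos : 0 < P.pairingIn ℤ i j :=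
    (lt_or_gt_of_ne h).resolve_left fun hlt => (A.ends_of_pairingIn_neg hi hj hlt).2.1 ht
  rcases eq_or_ne i j with rfl | hij
  · simp
  obtain ⟨k, hk⟩ := P.root_sub_root_mem_of_pairingIn_pos hpos hij
  rw [← hk]
  by_contra hk'
  have := A.ends_of_root_eq_add (i := k) (j := j) (k := i) (by simp [hk]) hk' hj hi
  rw [A.root_notMem_iff] at hk' hi
  grind

end ArrowLabelling

end Arrows

namespace ArrowLabelling

open Module RootPairing

section Equivalence

variable {ι K M N : Type*} [Field K] [CharZero K] [AddCommGroup M] [Module K M] [AddCommGroup N]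
  [Module K N] [Finite ι] {P : RootPairing ι K M N} [P.IsCrystallographic]
  {Q : Submodule K M} {V : Type*} [DecidableEq V] (A : ArrowLabelling V P Q)

include A

/-- If `i` and `j` are orthogonal, then the reflection of `i` in `k` is a root with the same arrow
as `i` that is not orthogonal to `j`. -/
theorem sub_mem_of_pairingIn_ne_zero_of_mem {i j k : ι} (ht : A.tgt i = A.tgt j)
    (hs : A.src i = A.src j) (hi : P.root i ∉ Q) (hk : P.root k ∈ Q)
    (hik : P.pairingIn ℤ i k ≠ 0) (hkj : P.pairingIn ℤ k j ≠ 0) : P.root i - P.root j ∈ Q := by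
  by_cases hij : P.pairingIn ℤ i j = 0
  swap; · exact A.sub_mem_of_pairingIn_ne_zero ht hs hi hij
  have hrefl : P.root (P.reflectionPerm k i) = P.root i - P.pairing i k • P.root k := by
    rw [P.root_reflectionPerm, P.reflection_apply_root]
  have hmem : P.root (P.reflectionPerm k i) - P.root i ∈ Q := by
    simpa [hrefl] using Q.smul_mem _ hk
  have hi' : P.root (P.reflectionPerm k i) ∉ Q := fun h => hi (by simpa using Q.sub_mem h hmem)
  obtain ⟨ht', hs'⟩ := A.ends_eq_of_sub_mem hmem hi'
  have hpair : P.pairingIn ℤ (P.reflectionPerm k i) j ≠ 0 := by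
    have hK : P.pairing i k ≠ 0 ∧ P.pairing k j ≠ 0 ∧ P.pairing i j = 0 := by
      simp [← P.algebraMap_pairingIn ℤ, hik, hkj, hij]
    rw [← (algebraMap ℤ K).injective_int.ne_iff, P.algebraMap_pairingIn ℤ, map_zero,
      ← P.root_coroot'_eq_pairing, hrefl]
    simp [hK]
  simpa using Q.sub_mem
    (A.sub_mem_of_pairingIn_ne_zero (ht'.trans ht) (hs'.trans hs) hi' hpair) hmem

/-- If the arrow of `k` shares only one end with that of `i` and `j`, then `i - k` shares the other
end with `j`, so its pairing with `j` cannot be negative. -/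
theorem sub_mem_of_pairingIn_pos_of_notMem {i j k : ι} (ht : A.tgt i = A.tgt j)
    (hs : A.src i = A.src j) (hi : P.root i ∉ Q) (hk : P.root k ∉ Q)
    (hik : 0 < P.pairingIn ℤ i k) (hkj : P.pairingIn ℤ k j ≠ 0) : P.root i - P.root j ∈ Q := by
  have hj : P.root j ∉ Q := by rwa [A.root_notMem_iff, ← ht, ← hs, ← A.root_notMem_iff]
  by_cases hij : P.pairingIn ℤ i j = 0
  swap; · exact A.sub_mem_of_pairingIn_ne_zero ht hs hi hij
  obtain ⟨hend, -, -⟩ := A.ends_of_pairingIn_pos hi hk hik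
  have hkj' : 0 < P.pairingIn ℤ k j := by
    refine (lt_or_gt_of_ne hkj).resolve_left fun hlt => ?_
    have := A.ends_of_pairingIn_neg hk hj hlt
    grind
  by_cases hsame : A.tgt i = A.tgt k ∧ A.src i = A.src k
  · obtain ⟨ht', hs'⟩ := hsame
    simpa using Q.add_mem (A.sub_mem_of_pairingIn_ne_zero ht' hs' hi hik.ne')
      (A.sub_mem_of_pairingIn_ne_zero (ht'.symm.trans ht) (hs'.symm.trans hs) hk hkj)
  · exfalso
    obtain ⟨a, ha⟩ := P.root_sub_root_mem_of_pairingIn_pos hik fun h => hkj (h ▸ hij)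
    have hadd : P.root i = P.root a + P.root k := by simp [ha]
    have haQ : P.root a ∉ Q := fun h => hsame (A.ends_eq_of_sub_mem (ha ▸ h) hi)
    have haj : P.pairingIn ℤ a j < 0 := by
      have := P.pairingIn_eq_add_of_root_eq_add (S := ℤ) (j := j) hadd
      omega
    have h₁ := A.ends_of_root_eq_add hadd haQ hk hi
    have h₂ := A.ends_of_pairingIn_neg haQ hj haj
    grind

theorem sub_mem [P.IsIrreducible] {i j : ι} (ht : A.tgt i = A.tgt j) (hs : A.src i = A.src j) :
    P.root i - P.root j ∈ Q := by
  by_cases hi : P.root i ∈ Q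
  · exact Q.sub_mem hi (by rwa [A.root_mem_iff, ← ht, ← hs, ← A.root_mem_iff])
  obtain ⟨k, hki, hkj⟩ : ∃ k, P.pairingIn ℤ k i ≠ 0 ∧ P.pairingIn ℤ k j ≠ 0 := by
    obtain ⟨k, hk⟩ := exists_root_apply_ne_zero_and (P := P) (f := P.coroot' i) (g := P.coroot' j)
      ⟨i, by simp⟩ ⟨j, by simp⟩
    simp only [P.root_coroot'_eq_pairing, ← P.algebraMap_pairingIn ℤ] at hk
    exact ⟨k, by simpa using hk⟩
  have hik : P.pairingIn ℤ i k ≠ 0 := by rwa [Ne, P.pairingIn_eq_zero_iff]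
  by_cases hk : P.root k ∈ Q
  · exact A.sub_mem_of_pairingIn_ne_zero_of_mem ht hs hi hk hik hkj
  rcases lt_or_gt_of_ne hik with hneg | hpos
  · exact A.sub_mem_of_pairingIn_pos_of_notMem (k := P.reflectionPerm k k) ht hs hi
      (by simpa using hk) (by simpa using hneg) (by simpa using hkj)
  · exact A.sub_mem_of_pairingIn_pos_of_notMem ht hs hi hk hpos hkj

theorem add_mem [P.IsIrreducible] {i j : ι} (ht : A.tgt i = A.src j) (hs : A.src i = A.tgt j) :
    P.root i + P.root j ∈ Q := by
  by_cases hj : P.root j ∈ Q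
  · refine Q.add_mem ?_ hj
    rw [A.root_mem_iff] at hj ⊢
    rw [ht, hs, hj]
  obtain ⟨ht', hs'⟩ := A.ends_of_root_eq_neg (j := P.reflectionPerm j j) (by simp) hj
  simpa using A.sub_mem (ht.trans ht'.symm) (hs.trans hs'.symm)

theorem exists_pairingIn_neg_and_touches [P.IsIrreducible] (i : ι) {j : ι} (hj : P.root j ∉ Q) :
    ∃ l, P.pairingIn ℤ l i < 0 ∧ P.root l ∉ Q ∧ (A.src j = A.tgt l ∨ A.src j = A.src l) := by
  obtain ⟨l, hli, hlj⟩ := exists_root_apply_ne_zero_and (P := P) (f := P.coroot' i)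
    (g := LinearMap.proj (A.src j) ∘ₗ A.toLin) ⟨i, by simp⟩
    ⟨j, A.toLin_root_apply_ne_zero_iff.2 ⟨hj, Or.inr rfl⟩⟩
  rw [P.root_coroot'_eq_pairing, ← P.algebraMap_pairingIn ℤ, algebraMap_int_eq,
    Int.coe_castRingHom, Int.cast_ne_zero] at hli
  rcases lt_or_gt_of_ne hli with hneg | hpos
  · exact ⟨l, hneg, A.toLin_root_apply_ne_zero_iff.1 hlj⟩
  · exact ⟨P.reflectionPerm l l, by simpa using hpos,
      A.toLin_root_apply_ne_zero_iff.1 (by simpa using hlj)⟩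

/-- A root `l` not orthogonal to `i` that touches the source of `j` has, up to sign, a sum with
`i`, and `l` and `l + i` have, up to sign and order, the arrows of `j` and `k`. -/
theorem sub_add_mem [P.IsIrreducible] {i j k : ι} (hi : P.root i ∉ Q) (hj : P.root j ∉ Q)
    (hk : P.root k ∉ Q) (hij : A.src i = A.tgt j) (hik : A.tgt k = A.tgt i)
    (hjk : A.src k = A.src j) : P.root k - (P.root i + P.root j) ∈ Q := by
  obtain ⟨l, hli, hl, hlj⟩ := A.exists_pairingIn_neg_and_touches i hj
  have hj' := A.root_notMem_iff.1 hj
  have hk' := A.root_notMem_iff.1 hk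
  have hend := A.ends_of_pairingIn_neg hl hi hli
  have hne : ¬(A.tgt l = A.src i ∧ A.src l = A.tgt i) := by grind
  obtain ⟨m, hm⟩ := P.root_add_root_mem_of_pairingIn_neg hli fun h =>
    hne (A.ends_of_root_eq_neg h hi)
  have hmQ : P.root m ∉ Q := fun h => hne <| by
    have hneg := A.ends_of_root_eq_neg (j := P.reflectionPerm i i) (by simp) hi
    have hsame := A.ends_eq_of_sub_mem (j := P.reflectionPerm i i) (by simpa [hm] using h) hl
    exact ⟨hsame.1.trans hneg.1, hsame.2.trans hneg.2⟩
  have hcomp := A.ends_of_root_eq_add hm hl hi hmQ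
  rcases eq_or_ne (A.tgt l) (A.src i) with htl | htl
  · have hkm := A.sub_mem (i := k) (j := m) (by grind) (by grind)
    have hlj' := A.sub_mem (i := l) (j := j) (by grind) (by grind)
    convert Q.add_mem hkm hlj' using 1
    rw [hm]
    abel
  · have hkl := A.add_mem (i := k) (j := l) (by grind) (by grind)
    have hjm := A.add_mem (i := j) (j := m) (by grind) (by grind)
    convert Q.sub_mem hkl hjm using 1
    rw [hm]
    abel

end Equivalence

end ArrowLabelling

section TypeAQuotient

open Module RootPairing

variable {ι K M N : Type*} [Field K] [AddCommGroup M] [Module K M] [AddCommGroup N] [Module K N]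

/-- The nonzero images of the roots in `M ⧸ Q` form a root system of type `A` with set of
coordinates `V`; the linear isomorphism need not preserve inner products. -/
def IsTypeAQuotient (P : RootPairing ι K M N) (Q : Submodule K M) (V : Type*) [DecidableEq V] :
    Prop :=
  ∃ e : (M ⧸ Q) ≃ₗ[K] Submodule.span K (arrows K V),
    (fun q => (e q : V → K)) '' {q | q ≠ 0 ∧ ∃ i, q = Q.mkQ (P.root i)} = arrows K V

namespace ArrowLabelling

variable [CharZero K] [Finite ι] {P : RootPairing ι K M N} [P.IsCrystallographic]
  [P.IsIrreducible] {Q : Submodule K M} {V : Type*} [DecidableEq V] {A : ArrowLabelling V P Q}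

/-- The value of `g` at `v` is the class of any root with an arrow from a fixed base point to
`v`. -/
theorem IsFull.exists_mkQ_root_eq_sub (hA : A.IsFull) :
    ∃ g : V → M ⧸ Q, ∀ i, Q.mkQ (P.root i) = g (A.tgt i) - g (A.src i) := by
  rcases isEmpty_or_nonempty V with hV | ⟨⟨o⟩⟩
  · exact ⟨0, fun i => (hV.false (A.tgt i)).elim⟩
  have hclass : ∀ v, ∃ q : M ⧸ Q, (v = o → q = 0) ∧
      (v ≠ o → ∃ i, A.tgt i = v ∧ A.src i = o ∧ Q.mkQ (P.root i) = q) := fun v => by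
    by_cases hv : v = o
    · exact ⟨0, by simp [hv]⟩
    · obtain ⟨i, ht, hs⟩ := hA v o hv
      exact ⟨Q.mkQ (P.root i), by simp [hv], fun _ => ⟨i, ht, hs, rfl⟩⟩
  choose g g_base hg using hclass
  refine ⟨g, fun i => ?_⟩
  by_cases hi : P.root i ∈ Q
  · rw [(A.root_mem_iff i).1 hi, sub_self]
    simpa using hi
  by_cases ht : A.tgt i = o
  · obtain ⟨j, htj, hsj, hj⟩ := hg (A.src i) fun h => A.root_notMem_iff.1 hi (ht.trans h.symm)
    rw [g_base _ ht, zero_sub, eq_neg_iff_add_eq_zero, ← hj, ← map_add]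
    exact (Submodule.Quotient.mk_eq_zero Q).2 (A.add_mem (ht.trans hsj.symm) htj.symm)
  obtain ⟨k, htk, hsk, hk⟩ := hg (A.tgt i) ht
  by_cases hs : A.src i = o
  · rw [g_base _ hs, sub_zero, ← hk, ← sub_eq_zero, ← map_sub]
    exact (Submodule.Quotient.mk_eq_zero Q).2 (A.sub_mem htk.symm (hs.trans hsk.symm))
  obtain ⟨j, htj, hsj, hj⟩ := hg (A.src i) hs
  rw [eq_sub_iff_add_eq', ← hj, ← hk, ← map_add, add_comm, eq_comm, ← sub_eq_zero, ← map_sub]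
  have hj' : P.root j ∉ Q := A.root_notMem_iff.2 fun h => hs (by rw [← htj, h, hsj])
  have hk' : P.root k ∉ Q := A.root_notMem_iff.2 fun h => ht (by rw [← htk, h, hsk])
  exact (Submodule.Quotient.mk_eq_zero Q).2
    (A.sub_add_mem hi hj' hk' htj.symm htk (hsk.trans hsj.symm))

theorem IsFull.exists_apply_root_eq_sub (hA : A.IsFull) {φ : Dual K M}
    (hφ : Q ≤ LinearMap.ker φ) : ∃ x : V → K, ∀ i, φ (P.root i) = x (A.tgt i) - x (A.src i) := by
  obtain ⟨g, hg⟩ := hA.exists_mkQ_root_eq_sub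
  exact ⟨fun v => Q.liftQ φ hφ (g v), fun i => by rw [← map_sub, ← hg]; rfl⟩

theorem IsFull.ker_toLin [P.IsRootSystem] [Finite V] (hA : A.IsFull) :
    LinearMap.ker A.toLin = Q := by
  refine le_antisymm (fun x hx => ?_) A.le_ker
  obtain ⟨g, hg⟩ := hA.exists_mkQ_root_eq_sub
  let G : (V → K) →ₗ[K] M ⧸ Q := (Pi.basisFun K V).constr K g
  have hG : ∀ v, G (Pi.single v 1) = g v := fun v => by
    rw [← Pi.basisFun_apply, Basis.constr_basis]
  have hcomp : G ∘ₗ A.toLin = Q.mkQ :=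
    LinearMap.ext_on_range (v := P.root) IsRootSystem.span_root_eq_top fun i => by
      rw [LinearMap.comp_apply, A.toLin_root, map_sub, hG, hG, hg]
  simpa [LinearMap.mem_ker.1 hx] using (LinearMap.congr_fun hcomp x).symm

theorem IsFull.isTypeAQuotient [P.IsRootSystem] [Finite V] (hA : A.IsFull) :
    IsTypeAQuotient P Q V := by
  let F : (M ⧸ Q) →ₗ[K] (V → K) := Q.liftQ A.toLin A.le_ker
  have hF : Function.Injective F := by
    rw [← LinearMap.ker_eq_bot, Submodule.ker_liftQ, hA.ker_toLin, Submodule.mkQ_map_self]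
  have himage : F '' {q | q ≠ 0 ∧ ∃ i, q = Q.mkQ (P.root i)} = arrows K V := by
    ext v
    constructor
    · rintro ⟨_, ⟨h0, i, rfl⟩, rfl⟩
      exact ⟨A.tgt i, A.src i, A.root_notMem_iff.1 (by simpa using h0), A.toLin_root i⟩
    · rintro ⟨s, t, hst, rfl⟩
      obtain ⟨i, rfl, rfl⟩ := hA s t hst
      exact ⟨Q.mkQ (P.root i), ⟨by simpa using A.root_notMem_iff.2 hst, i, rfl⟩, A.toLin_root i⟩
  have hrange : LinearMap.range F = Submodule.span K (arrows K V) := by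
    apply le_antisymm
    · rw [Submodule.range_liftQ, LinearMap.range_eq_map,
        ← IsRootSystem.span_root_eq_top (P := P), Submodule.map_span, Submodule.span_le]
      rintro _ ⟨_, ⟨i, rfl⟩, rfl⟩
      by_cases h : A.tgt i = A.src i
      · simp [A.toLin_root, h]
      · exact Submodule.subset_span ⟨_, _, h, A.toLin_root i⟩
    · rw [Submodule.span_le, ← himage]
      rintro _ ⟨x, -, rfl⟩
      exact ⟨x, rfl⟩
  exact ⟨(LinearEquiv.ofInjective F hF).trans (LinearEquiv.ofEq _ _ hrange), himage⟩

end ArrowLabelling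

end TypeAQuotient

section Restriction

open Module RootPairing

variable {ι K M N : Type*} [Field K] [CharZero K] [AddCommGroup M] [Module K M] [AddCommGroup N]
  [Module K N] {P : RootPairing ι K M N} {Q : Submodule K M} {V : Type*} [DecidableEq V]

namespace ArrowLabelling

variable (A : ArrowLabelling V P Q)

/-- The labelling obtained by discarding the points of `V` outside the range of `e`, at which only
trivial arrows may end. -/
noncomputable def restrict {W : Type*} [DecidableEq W] [Nonempty W] (e : W → V)
    (he : Function.Injective e)
    (h : ∀ i, P.root i ∉ Q → A.tgt i ∈ Set.range e ∧ A.src i ∈ Set.range e) :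
    ArrowLabelling W P Q where
  src i := Function.invFun e (A.src i)
  tgt i := Function.invFun e (A.tgt i)
  toLin := LinearMap.funLeft K K e ∘ₗ A.toLin
  toLin_root i := by
    by_cases hi : P.root i ∈ Q
    · rw [LinearMap.comp_apply, LinearMap.mem_ker.1 (A.le_ker hi), (A.root_mem_iff i).1 hi,
        sub_self, map_zero]
    · obtain ⟨⟨u, hu⟩, v, hv⟩ := h i hi
      ext w
      simp [A.toLin_root, ← hu, ← hv, Function.leftInverse_invFun he _, Pi.single_apply, he.eq_iff]
  root_mem_iff i := by
    refine ⟨fun hi => congrArg _ ((A.root_mem_iff i).1 hi), fun hi => ?_⟩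
    by_contra hiQ
    obtain ⟨⟨u, hu⟩, v, hv⟩ := h i hiQ
    refine A.root_notMem_iff.1 hiQ ?_
    simp only [← hu, ← hv, Function.leftInverse_invFun he _] at hi ⊢
    rw [hi]
  le_ker := A.le_ker.trans (LinearMap.ker_le_ker_comp _ _)

variable [Finite ι] [P.IsCrystallographic] [P.IsIrreducible]

theorem isFull_of_forall_exists (h : ∀ v, ∃ i, A.toLin (P.root i) v ≠ 0) : A.IsFull := by
  intro u v huv
  obtain ⟨i, hu, hv⟩ := exists_root_apply_ne_zero_and (P := P)
    (f := LinearMap.proj u ∘ₗ A.toLin) (g := LinearMap.proj v ∘ₗ A.toLin) (h u) (h v)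
  obtain ⟨hi, hu⟩ := A.toLin_root_apply_ne_zero_iff.1 hu
  obtain ⟨-, hv⟩ := A.toLin_root_apply_ne_zero_iff.1 hv
  have hneg := A.ends_of_root_eq_neg (j := P.reflectionPerm i i) (by simp) hi
  by_cases htu : u = A.tgt i
  · exact ⟨i, by grind, by grind⟩
  · exact ⟨P.reflectionPerm i i, by grind, by grind⟩

include A in
theorem exists_isFull_fin : ∃ (k : ℕ) (B : ArrowLabelling (Fin (k + 1)) P Q), B.IsFull := by
  by_cases hQ : ∀ i, P.root i ∈ Q
  · exact ⟨0, ⟨0, 0, 0, by simp, by simpa using hQ, by simp⟩,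
      fun u v huv => (huv (Subsingleton.elim (α := Fin 1) u v)).elim⟩
  obtain ⟨i₀, hi₀⟩ := not_forall.1 hQ
  let W : Set V := {v | ∃ i, A.toLin (P.root i) v ≠ 0}
  have htgt : ∀ i, P.root i ∉ Q → A.tgt i ∈ W := fun i hi =>
    ⟨i, A.toLin_root_apply_ne_zero_iff.2 ⟨hi, Or.inl rfl⟩⟩
  have hsrc : ∀ i, P.root i ∉ Q → A.src i ∈ W := fun i hi =>
    ⟨i, A.toLin_root_apply_ne_zero_iff.2 ⟨hi, Or.inr rfl⟩⟩
  have hfin : W.Finite :=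
    ((Set.finite_range A.tgt).union (Set.finite_range A.src)).subset fun v ⟨i, hi⟩ =>
      (A.toLin_root_apply_ne_zero_iff.1 hi).2.imp (fun h => ⟨i, h.symm⟩) fun h => ⟨i, h.symm⟩
  have : Finite W := hfin
  have : Nonempty W := ⟨⟨_, htgt i₀ hi₀⟩⟩
  obtain ⟨k, hk⟩ := Nat.exists_eq_succ_of_ne_zero (Nat.card_pos (α := W)).ne'
  let e : Fin (k + 1) ≃ W := (Finite.equivFinOfCardEq hk).symm
  have hrange : Set.range (fun v => (e v : V)) = W := by
    rw [Set.range_comp' Subtype.val e, e.range_eq_univ, Set.image_univ, Subtype.range_coe]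
  refine ⟨k, A.restrict (fun v => e v) (Subtype.val_injective.comp e.injective) fun i hi => ?_,
    isFull_of_forall_exists _ fun v => (e v).2⟩
  rw [hrange]
  exact ⟨htgt i hi, hsrc i hi⟩

end ArrowLabelling

end Restriction

section QuadraticPairs

open Module RootPairing

variable {ι K M N : Type*} [Field K] [CharZero K] [AddCommGroup M] [Module K M] [AddCommGroup N]
  [Module K N]

/-- The quadratic relations between the coefficients of two invariant brackets, one of which is
closed and the other of which squares to the trivector `φ`. -/
def IsQuadraticPair (P : RootPairing ι K M N) (l m : Dual K M) : Prop :=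
  (∀ i, l (P.root i) = 0 → m (P.root i) = 0) ∧
    ∀ i j k, P.root k = P.root i + P.root j →
      (m (P.root j) * l (P.root i) - m (P.root i) * l (P.root j)) ^ 2 =
        (l (P.root i) * l (P.root j) * l (P.root k)) ^ 2

/-- If `a` and `a'` are the values of `l` at `i` and `j` and `s`, `s'` those of `m / l`, then
this is additivity of the indicator function of the arrow from `(s - a) / 2` to `(s + a) / 2`. -/
theorem indicator_add_of_sq_eq [DecidableEq K] {a a' p p' : K} (v : K)
    (hi : a = 0 → p = 0) (hj : a' = 0 → p' = 0) (hk : a + a' = 0 → p + p' = 0)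
    (hq : (p' * a - p * a') ^ 2 = (a * a' * (a + a')) ^ 2) :
    ((if v = ((p + p') / (a + a') + (a + a')) / 2 then 1 else 0) -
      (if v = ((p + p') / (a + a') - (a + a')) / 2 then 1 else 0) : K) =
    ((if v = (p / a + a) / 2 then 1 else 0) - (if v = (p / a - a) / 2 then 1 else 0)) +
    ((if v = (p' / a' + a') / 2 then 1 else 0) - (if v = (p' / a' - a') / 2 then 1 else 0)) := by
  by_cases ha : a = 0
  · simp [ha, hi ha]
  by_cases ha' : a' = 0
  · simp [ha', hj ha']
  by_cases haa : a + a' = 0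
  · obtain rfl : a' = -a := by linear_combination haa
    obtain rfl : p' = -p := by linear_combination hk haa
    simp [sub_eq_add_neg]
  obtain ⟨s, rfl⟩ : ∃ s, p = s * a := ⟨p / a, by field_simp⟩
  obtain ⟨s', rfl⟩ : ∃ s', p' = s' * a' := ⟨p' / a', by field_simp⟩
  rw [mul_div_cancel_right₀ s ha, mul_div_cancel_right₀ s' ha']
  have hs : (s' - s) ^ 2 = (a + a') ^ 2 :=
    mul_left_cancel₀ (pow_ne_zero 2 (mul_ne_zero ha ha')) (by linear_combination hq)
  rcases sq_eq_sq_iff_eq_or_eq_neg.1 hs with h | h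
  · obtain rfl : s' = s + (a + a') := by linear_combination h
    rw [show (s * a + (s + (a + a')) * a') / (a + a') = s + a' by field_simp; ring]
    ring_nf
  · obtain rfl : s' = s - (a + a') := by linear_combination h
    rw [show (s * a + (s - (a + a')) * a') / (a + a') = s - a' by field_simp; ring]
    ring_nf

section

variable {P : RootPairing ι K M N} {l m : Dual K M}

open Classical in
/-- The points of the labelling are elements of `K`: the arrow of a root at which `l` and `m / l`
take the values `a` and `s` goes from `(s - a) / 2` to `(s + a) / 2`. -/
theorem IsQuadraticPair.nonempty_arrowLabelling [Finite ι] [P.IsCrystallographic]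
    [P.IsRootSystem] (h : IsQuadraticPair P l m) (b : P.Base) {S : Set ι}
    (hS : ∀ i, P.root i ∈ Submodule.span K (P.root '' S) ↔ l (P.root i) = 0) :
    Nonempty (ArrowLabelling K P (Submodule.span K (P.root '' S))) := by
  let t (i : ι) : K := (m (P.root i) / l (P.root i) + l (P.root i)) / 2
  let s (i : ι) : K := (m (P.root i) / l (P.root i) - l (P.root i)) / 2
  let χ (v : K) (i : ι) : K := (if v = t i then 1 else 0) - (if v = s i then 1 else 0)
  have hadd : ∀ v i j k, P.root k = P.root i + P.root j → χ v k = χ v i + χ v j := by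
    intro v i j k hk
    have hk₀ := h.1 k
    have hq := h.2 i j k hk
    simp only [hk, map_add] at hk₀ hq
    simpa only [χ, t, s, hk, map_add] using indicator_add_of_sq_eq v (h.1 i) (h.1 j) hk₀ hq
  have hneg : ∀ v i, χ v (P.reflectionPerm i i) = -χ v i := by
    intro v i
    have hi : P.root (P.reflectionPerm i i) = -P.root i := by simp
    simp only [χ, t, s, hi, map_neg, neg_div_neg_eq, sub_neg_eq_add, neg_sub, ← sub_eq_add_neg]
  choose F hF using fun v => exists_dual_of_additive b (χ v) (hneg v) (hadd v)
  have hF_root : ∀ i, LinearMap.pi F (P.root i) = Pi.single (t i) 1 - Pi.single (s i) 1 :=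
    fun i => by
      ext v
      simp [hF, χ, Pi.single_apply]
  have hts : ∀ i, l (P.root i) = 0 ↔ t i = s i := fun i => by
    simp only [t, s]
    grind
  refine ⟨⟨s, t, LinearMap.pi F, hF_root, fun i => (hS i).trans (hts i), ?_⟩⟩
  rw [Submodule.span_le]
  rintro _ ⟨i, hi, rfl⟩
  have hli := (hS i).1 (Submodule.subset_span ⟨i, hi, rfl⟩)
  rw [SetLike.mem_coe, LinearMap.mem_ker, hF_root, (hts i).1 hli, sub_self]

end

variable {P : RootPairing ι K M N} {V : Type*} [DecidableEq V]

/-- With `l = x (tgt ·) - x (src ·)`, one can take `m = x (tgt ·) ^ 2 - x (src ·) ^ 2`. -/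
theorem ArrowLabelling.exists_isQuadraticPair {Q : Submodule K M} [Finite V]
    (A : ArrowLabelling V P Q) {l : Dual K M} {x : V → K}
    (hl : ∀ i, l (P.root i) = x (A.tgt i) - x (A.src i)) : ∃ m, IsQuadraticPair P l m := by
  have := Fintype.ofFinite V
  let m : Dual K M := ∑ v, x v ^ 2 • (LinearMap.proj v ∘ₗ A.toLin)
  have hm : ∀ i, m (P.root i) = x (A.tgt i) ^ 2 - x (A.src i) ^ 2 := fun i => by
    simp [m, LinearMap.sum_apply, A.toLin_root, Pi.single_apply, mul_sub, Finset.sum_sub_distrib]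
  have hm₀ : ∀ i, l (P.root i) = 0 → m (P.root i) = 0 := fun i hi => by
    rw [hm]
    rw [hl] at hi
    linear_combination (x (A.tgt i) + x (A.src i)) * hi
  have hQ : ∀ i, l (P.root i) ≠ 0 → P.root i ∉ Q := fun i hi h => hi (by
    rw [hl, (A.root_mem_iff i).1 h, sub_self])
  refine ⟨m, hm₀, fun i j k hk => ?_⟩
  have hlk : l (P.root k) = l (P.root i) + l (P.root j) := by rw [hk, map_add]
  have hmk : m (P.root k) = m (P.root i) + m (P.root j) := by rw [hk, map_add]
  by_cases hi : l (P.root i) = 0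
  · simp [hi, hm₀ i hi]
  by_cases hj : l (P.root j) = 0
  · simp [hj, hm₀ j hj]
  by_cases hk₀ : l (P.root k) = 0
  · have hmk₀ := hm₀ k hk₀
    have : m (P.root j) * l (P.root i) - m (P.root i) * l (P.root j) = 0 := by
      linear_combination l (P.root i) * (hmk₀ - hmk) - m (P.root i) * (hk₀ - hlk)
    simp [this, hk₀]
  · rw [hlk, hm, hm, hl, hl]
    rcases A.ends_of_root_eq_add hk (hQ i hi) (hQ j hj) (hQ k hk₀) with ⟨h, -⟩ | ⟨h, -⟩ <;>
    · rw [h]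
      ring

theorem exists_isQuadraticPair_of_ker_le [Finite V] (F : M →ₗ[K] (V → K))
    (hF : ∀ i, ∃ t s, F (P.root i) = Pi.single t 1 - Pi.single s 1) {l : Dual K M}
    (hl : LinearMap.ker F ≤ LinearMap.ker l) : ∃ m, IsQuadraticPair P l m := by
  choose t s hts using hF
  have hinj : Function.Injective fun v : V => (Pi.single v 1 : V → K) := fun u v h => by
    simpa [Pi.single_apply] using congrFun h u
  let A : ArrowLabelling V P (LinearMap.ker F) :=
    { src := s
      tgt := t
      toLin := F
      toLin_root := hts
      root_mem_iff := fun i => by rw [LinearMap.mem_ker, hts, sub_eq_zero, hinj.eq_iff]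
      le_ker := le_rfl }
  obtain ⟨φ, rfl⟩ : l ∈ LinearMap.range F.dualMap := by
    rwa [LinearMap.range_dualMap_eq_dualAnnihilator_ker, Submodule.mem_dualAnnihilator]
  exact A.exists_isQuadraticPair (x := fun v => φ (Pi.single v 1)) fun i => by
    rw [LinearMap.dualMap_apply, hts, map_sub]

end QuadraticPairs

section HighestRoot

open Module RootPairing

variable {ι K M N : Type*} [Field K] [CharZero K] [AddCommGroup M] [Module K M] [AddCommGroup N]
  [Module K N] {P : RootPairing ι K M N} {b : P.Base}

theorem isPos_or_exists_isPos_root_eq_neg (i : ι) :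
    b.IsPos i ∨ ∃ j, b.IsPos j ∧ P.root j = -P.root i := by
  let := P.indexNeg
  exact (Base.IsPos.or_neg b i).imp_right fun h => ⟨-i, h, by simp⟩

theorem root_ne_neg_of_isPos {i j : ι} (hi : b.IsPos i) (hj : b.IsPos j) :
    P.root i ≠ -P.root j := by
  let := P.indexNeg
  intro h
  obtain rfl : i = -j := P.root.injective (by simp [h])
  exact (Base.IsPos.neg_iff_not b j).1 hi hj

theorem isPos_mem_closure [Finite ι] [P.IsCrystallographic] {i : ι} (hi : b.IsPos i) :
    P.root i ∈ AddSubmonoid.closure (P.root '' (b.support : Set ι)) :=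
  hi.induction_on_add (p := fun i => P.root i ∈ AddSubmonoid.closure _)
    (fun _ hi => AddSubmonoid.subset_closure ⟨_, hi, rfl⟩)
    fun _ j _ hk hi hj => hk ▸ add_mem hi (AddSubmonoid.subset_closure ⟨j, hj, rfl⟩)

theorem exists_nat_repr_of_mem_closure [P.IsRootSystem] {x : M}
    (hx : x ∈ AddSubmonoid.closure (P.root '' (b.support : Set ι))) (d : b.support) :
    ∃ n : ℕ, b.toWeightBasis.repr x d = n := by
  classical
  induction hx using AddSubmonoid.closure_induction with
  | mem x hx =>
    obtain ⟨i, hi, rfl⟩ := hx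
    exact ⟨Finsupp.single ⟨i, hi⟩ 1 d, by
      simp [b.toWeightBasis_repr_root ⟨i, hi⟩, Finsupp.single_apply]⟩
  | zero => exact ⟨0, by simp⟩
  | add x y _ _ hx hy =>
    obtain ⟨n, hn⟩ := hx
    obtain ⟨m, hm⟩ := hy
    exact ⟨n + m, by simp [hn, hm]⟩

theorem pairingIn_eq_sum [P.IsCrystallographic] [P.IsRootSystem] {i : ι} {n : b.support → ℕ}
    (hn : ∀ d, b.toWeightBasis.repr (P.root i) d = n d) (j : ι) :
    P.pairingIn ℤ i j = ∑ d, n d * P.pairingIn ℤ d j := by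
  apply FaithfulSMul.algebraMap_injective ℤ K
  rw [P.algebraMap_pairingIn, map_sum, ← P.root_coroot'_eq_pairing]
  conv_lhs => rw [← b.toWeightBasis.sum_repr (P.root i), map_sum]
  refine Finset.sum_congr rfl fun d _ => ?_
  rw [map_smul, b.toWeightBasis_apply, hn, map_mul, P.algebraMap_pairingIn,
    P.root_coroot'_eq_pairing, smul_eq_mul, map_natCast]

variable (b) in
/-- The root `θ` is the maximal root: `θ - β` is a sum of simple roots for every root `β`. -/
def IsHighest (θ : ι) : Prop :=
  ∀ i, P.root θ - P.root i ∈ AddSubmonoid.closure (P.root '' (b.support : Set ι))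

variable (b) in
/-- The positive root `i` is maximal in the weak sense that no positive root can be added to it. -/
def IsAddMaximal (i : ι) : Prop :=
  b.IsPos i ∧ ∀ j k, b.IsPos j → P.root k ≠ P.root i + P.root j

variable [Finite ι] [P.IsCrystallographic]

theorem exists_isAddMaximal_sub_mem {i : ι} (hi : b.IsPos i) :
    ∃ j, IsAddMaximal b j ∧
      P.root j - P.root i ∈ AddSubmonoid.closure (P.root '' (b.support : Set ι)) := by
  let S : Set ι := {j | b.IsPos j ∧
    P.root j - P.root i ∈ AddSubmonoid.closure (P.root '' (b.support : Set ι))}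
  obtain ⟨j, hj, hmax⟩ := Set.exists_max_image S b.height (Set.toFinite S) ⟨i, hi, by simp⟩
  refine ⟨j, ⟨hj.1, fun g k hg hk => ?_⟩, hj.2⟩
  have hkS : k ∈ S := by
    refine ⟨hj.1.add hg hk, ?_⟩
    rw [hk, add_sub_right_comm]
    exact add_mem hj.2 (isPos_mem_closure hg)
  have hheight := hmax k hkS
  rw [b.height_add hk] at hheight
  have := b.isPos_iff.1 hg
  omega

theorem IsAddMaximal.pairingIn_nonneg {i : ι} (hi : IsAddMaximal b i) {j : ι} (hj : b.IsPos j) :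
    0 ≤ P.pairingIn ℤ i j := by
  by_contra! h
  obtain ⟨k, hk⟩ := P.root_add_root_mem_of_pairingIn_neg h (root_ne_neg_of_isPos hi.1 hj)
  exact hi.2 j k hj hk

variable [P.IsRootSystem]

theorem exists_nat_repr_root {i : ι} (hi : b.IsPos i) :
    ∃ n : b.support → ℕ, ∀ d, b.toWeightBasis.repr (P.root i) d = n d :=
  Classical.axiom_of_choice fun d => exists_nat_repr_of_mem_closure (isPos_mem_closure hi) d

theorem IsHighest.repr_of_isPos {θ : ι} (hθ : IsHighest b θ) {d : b.support}
    (hd : b.toWeightBasis.repr (P.root θ) d = 1) {i : ι} (hi : b.IsPos i) :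
    b.toWeightBasis.repr (P.root i) d = 0 ∨ b.toWeightBasis.repr (P.root i) d = 1 := by
  obtain ⟨n, hn⟩ := exists_nat_repr_of_mem_closure (hθ i) d
  obtain ⟨m, hm⟩ := exists_nat_repr_root hi
  rw [map_sub, Finsupp.sub_apply, hd, hm, sub_eq_iff_eq_add] at hn
  norm_cast at hn
  rw [hm]
  norm_cast
  omega

variable [P.IsReduced] [P.IsIrreducible]

theorem IsAddMaximal.repr_ne_zero {i : ι} (hi : IsAddMaximal b i) (d : b.support) :
    b.toWeightBasis.repr (P.root i) d ≠ 0 := by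
  obtain ⟨n, hn⟩ := exists_nat_repr_root hi.1
  obtain ⟨d₀, hd₀⟩ : ∃ d₀, n d₀ ≠ 0 := by
    by_contra! h
    exact P.ne_zero i (b.toWeightBasis.repr.injective (Finsupp.ext fun d => by simp [hn, h]))
  rw [hn, Nat.cast_ne_zero]
  refine b.induction_on_cartanMatrix (fun d => n d ≠ 0) hd₀ fun d e hd hde he => ?_
  have hle : ∀ c ∈ Finset.univ, n c * P.pairingIn ℤ c e ≤ 0 := fun c _ => by
    rcases eq_or_ne c e with rfl | hce
    · simp [he]
    · exact mul_nonpos_of_nonneg_of_nonpos (by positivity) (b.cartanMatrix_le_zero_of_ne c e hce)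
  have hlt : n d * P.pairingIn ℤ d e < 0 := by
    refine mul_neg_of_pos_of_neg (by positivity) (lt_of_le_of_ne
      (b.cartanMatrix_le_zero_of_ne d e fun h => hd (h ▸ he)) fun h => hde ?_)
    exact b.cartanMatrix_apply_eq_zero_iff_symm.1 h
  have hnonneg := hi.pairingIn_nonneg (b.isPos_of_mem_support e.2)
  rw [pairingIn_eq_sum hn] at hnonneg
  exact hnonneg.not_gt ((Finset.sum_lt_sum hle ⟨d, Finset.mem_univ _, hlt⟩).trans_eq (by simp))

theorem IsAddMaximal.eq {i j : ι} (hi : IsAddMaximal b i) (hj : IsAddMaximal b j) : i = j := by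
  by_contra hne
  obtain ⟨n, hn⟩ := exists_nat_repr_root hi.1
  have hpos : 0 < P.pairingIn ℤ i j := by
    rw [pairingIn_eq_sum hn]
    obtain ⟨d, hd, hdj⟩ := hj.1.exists_mem_support_pos_pairingIn
    have hnd : n ⟨d, hd⟩ ≠ 0 := by simpa [hn] using hi.repr_ne_zero ⟨d, hd⟩
    have hnonneg : ∀ c : b.support, 0 ≤ P.pairingIn ℤ c j := fun c => by
      have := hj.pairingIn_nonneg (b.isPos_of_mem_support c.2)
      rwa [← not_lt, P.pairingIn_lt_zero_iff, not_lt]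
    exact Finset.sum_pos' (fun c _ => mul_nonneg (by positivity) (hnonneg c))
      ⟨⟨d, hd⟩, Finset.mem_univ _, mul_pos (by positivity) hdj⟩
  obtain ⟨k, hk⟩ := P.root_sub_root_mem_of_pairingIn_pos hpos hne
  rcases isPos_or_exists_isPos_root_eq_neg (b := b) k with hk' | ⟨l, hl, hlk⟩
  · exact hj.2 k i hk' (by rw [hk]; abel)
  · exact hi.2 l j hl (by rw [hlk, hk]; abel)

theorem exists_isHighest_and_isAddMaximal : ∃ θ, IsHighest b θ ∧ IsAddMaximal b θ := by
  have : Nonempty ι := by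
    by_contra! h
    have := IsIrreducible.nontrivial P
    have hspan : Submodule.span K (Set.range P.root) = ⊤ := IsRootSystem.span_root_eq_top
    rw [Set.range_eq_empty, Submodule.span_empty] at hspan
    exact bot_ne_top hspan
  obtain ⟨i, hi⟩ := b.support_nonempty
  obtain ⟨θ, hθ, -⟩ := exists_isAddMaximal_sub_mem (b.isPos_of_mem_support hi)
  refine ⟨θ, fun i => ?_, hθ⟩
  rcases isPos_or_exists_isPos_root_eq_neg (b := b) i with hi | ⟨j, hj, hji⟩
  · obtain ⟨k, hk, hki⟩ := exists_isAddMaximal_sub_mem hi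
    rwa [hθ.eq hk]
  · rw [sub_eq_add_neg, ← hji]
    exact add_mem (isPos_mem_closure hθ.1) (isPos_mem_closure hj)

end HighestRoot

section RelativeHeight

open Module RootPairing

variable {ι K M N : Type*} [Field K] [AddCommGroup M] [Module K M] [AddCommGroup N]
  [Module K N] {P : RootPairing ι K M N} [P.IsRootSystem] {b : P.Base} {S : Set ι}

theorem mem_span_image_root_iff (hS : S ⊆ b.support) {x : M} :
    x ∈ Submodule.span K (P.root '' S) ↔
      ∀ d : b.support, d.1 ∉ S → b.toWeightBasis.repr x d = 0 := by
  have himage : P.root '' S = b.toWeightBasis '' {d | d.1 ∈ S} := by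
    ext x
    simp only [Set.mem_image, Set.mem_ofPred_eq, b.toWeightBasis_apply]
    exact ⟨fun ⟨i, hi, h⟩ => ⟨⟨i, hS hi⟩, hi, h⟩, fun ⟨d, hd, h⟩ => ⟨d, hd, h⟩⟩
  rw [himage, Basis.mem_span_image, Set.subset_def]
  simp [not_imp_comm]

open Classical in
variable (b S) in
/-- The height relative to `S`: the sum of the coefficients at the simple roots outside `S`. -/
noncomputable def relHeight : Dual K M :=
  b.toWeightBasis.constr K fun d => if d.1 ∈ S then 0 else 1

theorem relHeight_root_of_notMem {i : ι} (hi : i ∈ b.support) (hiS : i ∉ S) :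
    relHeight b S (P.root i) = 1 := by
  simpa [relHeight, hiS] using b.toWeightBasis.constr_basis K
    (fun d => open Classical in if d.1 ∈ S then (0 : K) else 1) ⟨i, hi⟩

theorem relHeight_apply_of_mem (hS : S ⊆ b.support) {x : M}
    (hx : x ∈ Submodule.span K (P.root '' S)) : relHeight b S x = 0 := by
  classical
  rw [relHeight, b.toWeightBasis.constr_apply]
  refine Finset.sum_eq_zero fun d _ => ?_
  by_cases hd : d.1 ∈ S
  · simp [hd]
  · simp [(mem_span_image_root_iff hS).1 hx d hd]

variable [CharZero K] [Finite ι] [P.IsCrystallographic]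

theorem exists_int_relHeight_root (hS : S ⊆ b.support) (i : ι) :
    ∃ n : ℤ, relHeight b S (P.root i) = n ∧
      (n = 0 → P.root i ∈ Submodule.span K (P.root '' S)) := by
  classical
  have hpos : ∀ i, b.IsPos i → ∃ n : ℕ, relHeight b S (P.root i) = n ∧
      (n = 0 → P.root i ∈ Submodule.span K (P.root '' S)) := fun i hi => by
    obtain ⟨n, hn⟩ := exists_nat_repr_root hi
    refine ⟨∑ d : b.support with d.1 ∉ S, n d, ?_,
      fun h => (mem_span_image_root_iff hS).2 fun d hd => ?_⟩
    · rw [relHeight, b.toWeightBasis.constr_apply_fintype K]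
      simp [hn, Finset.sum_filter]
    · rw [Finset.sum_eq_zero_iff] at h
      rw [hn, h d (by simpa using hd), Nat.cast_zero]
  rcases isPos_or_exists_isPos_root_eq_neg (b := b) i with hi | ⟨j, hj, hji⟩
  · obtain ⟨n, hn, h⟩ := hpos i hi
    exact ⟨n, by simpa, by simpa⟩
  · obtain ⟨n, hn, h⟩ := hpos j hj
    rw [hji, map_neg, neg_eq_iff_eq_neg] at hn
    exact ⟨-n, by simpa, by simpa [hji] using h⟩

namespace ArrowLabelling

variable {V : Type*} [DecidableEq V] [P.IsIrreducible]
  {A : ArrowLabelling V P (Submodule.span K (P.root '' S))}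

theorem IsFull.exists_injective_int (hA : A.IsFull) (hS : S ⊆ b.support) :
    ∃ w : V → ℤ, Function.Injective w ∧
      ∀ d ∈ b.support, d ∉ S → w (A.tgt d) = w (A.src d) + 1 := by
  cases isEmpty_or_nonempty V with
  | inl h => exact ⟨isEmptyElim, fun v => isEmptyElim v, fun d => isEmptyElim (A.tgt d)⟩
  | inr h =>
  obtain ⟨v₀⟩ := h
  obtain ⟨x, hx⟩ := hA.exists_apply_root_eq_sub (φ := relHeight b S) fun y =>
    relHeight_apply_of_mem hS
  have hint : ∀ v, ∃ n : ℤ, x v - x v₀ = n := fun v => by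
    by_cases hv : v = v₀
    · exact ⟨0, by simp [hv]⟩
    · obtain ⟨i, rfl, rfl⟩ := hA v v₀ hv
      exact (exists_int_relHeight_root hS i).imp fun n hn => (hx i).symm.trans hn.1
  choose w hw using hint
  have hwx : ∀ i, relHeight b S (P.root i) = (w (A.tgt i) - w (A.src i) : ℤ) := fun i => by
    rw [hx, Int.cast_sub, ← hw, ← hw, sub_sub_sub_cancel_right]
  refine ⟨w, fun u v huv => ?_, fun d hd hdS => ?_⟩
  · by_contra hne
    obtain ⟨i, rfl, rfl⟩ := hA u v hne
    obtain ⟨n, hn, hmem⟩ := exists_int_relHeight_root hS i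
    rw [hwx, huv, sub_self, Int.cast_inj] at hn
    exact hne ((A.root_mem_iff i).1 (hmem hn.symm))
  · have := hwx d
    rw [relHeight_root_of_notMem hd hdS] at this
    have : w (A.tgt d) - w (A.src d) = 1 := by exact_mod_cast this.symm
    omega

theorem repr_root_eq [Finite V] (hS : S ⊆ b.support) {w : V → ℤ} (hw : Function.Injective w)
    (hstep : ∀ d ∈ b.support, d ∉ S → w (A.tgt d) = w (A.src d) + 1) (i : ι) {d : b.support}
    (hd : d.1 ∉ S) : b.toWeightBasis.repr (P.root i) d =
      ((if w (A.src d) < w (A.tgt i) then 1 else 0) -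
        (if w (A.src d) < w (A.src i) then 1 else 0) : ℤ) := by
  classical
  cases nonempty_fintype V
  let φ : Dual K M := ∑ v with w (A.src d) < w v, LinearMap.proj v ∘ₗ A.toLin
  have hφ : ∀ i, φ (P.root i) = ((if w (A.src d) < w (A.tgt i) then 1 else 0) -
      (if w (A.src d) < w (A.src i) then 1 else 0) : ℤ) := fun i => by
    simp [φ, LinearMap.sum_apply, A.toLin_root, Pi.single_apply]
  rw [← hφ, ← Basis.coord_apply]
  congr 1
  refine b.toWeightBasis.ext fun e => ?_
  rw [Basis.coord_apply, b.toWeightBasis_apply, hφ, b.toWeightBasis_repr_root]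
  by_cases he : e.1 ∈ S
  · have hed : e ≠ d := fun h => hd (h ▸ he)
    have := (A.root_mem_iff e).1 (Submodule.subset_span ⟨e, he, rfl⟩)
    simp [hed, this]
  · have hse := hstep e e.2 he
    have hsd := hstep d d.2 hd
    rcases eq_or_ne e d with rfl | hed
    · simp [hse]
    · have hne : w (A.src e) ≠ w (A.src d) := fun h => by
        have hmem := A.sub_mem (i := e) (j := d) (hw (by omega)) (hw h)
        have := (mem_span_image_root_iff hS).1 hmem d hd
        simp [b.toWeightBasis_repr_root, hed] at this
      rw [hse, Finsupp.single_eq_of_ne hed.symm]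
      split_ifs <;> first | omega | simp

end ArrowLabelling

end RelativeHeight

section PathGraph

variable {V : Type*} {G : SimpleGraph V}

theorem exists_adj_of_dist_eq_add_one (hG : G.Connected) {v₀ x : V} {n : ℕ}
    (hx : G.dist v₀ x = n + 1) : ∃ y, G.dist v₀ y = n ∧ G.Adj y x := by
  obtain ⟨p, hp⟩ := hG.exists_walk_length_eq_dist x v₀
  rw [SimpleGraph.dist_comm, hx] at hp
  cases p with
  | nil => simp at hp
  | @cons _ y _ hxy q =>
    have hle := SimpleGraph.dist_le q
    have hdiff := hxy.symm.diff_dist_adj (u := v₀)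
    rw [SimpleGraph.dist_comm] at hle
    rw [SimpleGraph.Walk.length_cons] at hp
    exact ⟨y, by omega, hxy.symm⟩

theorem dist_injective (hG : G.Connected) {v₀ : V}
    (hleaf : ∀ u v, G.Adj v₀ u → G.Adj v₀ v → u = v)
    (hdeg : ∀ x u v w, G.Adj x u → G.Adj x v → G.Adj x w → u = v ∨ u = w ∨ v = w) :
    Function.Injective (G.dist v₀) := by
  suffices ∀ n x y, G.dist v₀ x = n → G.dist v₀ y = n → x = y from
    fun x y hxy => this _ x y rfl hxy.symm
  intro n
  induction n using Nat.strong_induction_on with | _ n ih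
  intro x y hx hy
  match n with
  | 0 => exact (hG.dist_eq_zero_iff.1 hx).symm.trans (hG.dist_eq_zero_iff.1 hy)
  | 1 =>
    exact hleaf x y (SimpleGraph.dist_eq_one_iff_adj.1 hx) (SimpleGraph.dist_eq_one_iff_adj.1 hy)
  | n + 2 =>
    obtain ⟨x', hx', hx'x⟩ := exists_adj_of_dist_eq_add_one hG hx
    obtain ⟨y', hy', hy'y⟩ := exists_adj_of_dist_eq_add_one hG hy
    obtain rfl := ih (n + 1) (by omega) _ _ hx' hy'
    obtain ⟨z, hz, hzx'⟩ := exists_adj_of_dist_eq_add_one hG hx'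
    rcases hdeg x' x y z hx'x hy'y hzx'.symm with h | rfl | rfl
    · exact h
    · omega
    · omega

theorem nonempty_iso_pathGraph [Finite V] (hG : G.Connected) {v₀ : V}
    (hleaf : ∀ u v, G.Adj v₀ u → G.Adj v₀ v → u = v)
    (hdeg : ∀ x u v w, G.Adj x u → G.Adj x v → G.Adj x w → u = v ∨ u = w ∨ v = w) :
    Nonempty (G ≃g SimpleGraph.pathGraph (Nat.card V)) := by
  have hinj := dist_injective hG hleaf hdeg
  have hlt : ∀ x, G.dist v₀ x < Nat.card V := fun x => by
    have := Fintype.ofFinite V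
    obtain ⟨p, hp, hlen⟩ := hG.exists_path_of_dist v₀ x
    rw [Nat.card_eq_fintype_card, ← hlen]
    exact hp.length_lt
  let f : V → Fin (Nat.card V) := fun x => ⟨G.dist v₀ x, hlt x⟩
  have hf : Function.Bijective f := (Nat.bijective_iff_injective_and_card f).2
    ⟨fun x y hxy => hinj (Fin.val_eq_of_eq hxy), by simp⟩
  have hadj : ∀ {x y}, G.dist v₀ x + 1 = G.dist v₀ y → G.Adj x y := fun {x y} h => by
    obtain ⟨z, hz, hzy⟩ := exists_adj_of_dist_eq_add_one hG h.symm
    rwa [← hinj hz]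
  refine ⟨Equiv.ofBijective f hf, fun {x y} => ?_⟩
  rw [SimpleGraph.pathGraph_adj]
  refine ⟨fun h => h.elim hadj fun h => (hadj h).symm, fun h => ?_⟩
  have hdiff := h.diff_dist_adj (u := v₀)
  have hne := hinj.ne h.ne
  simp only [Equiv.ofBijective_apply, f]
  omega

end PathGraph

section DynkinDiagram

open Module RootPairing

variable {ι K M N : Type*} [Field K] [CharZero K] [AddCommGroup M] [Module K M] [AddCommGroup N]
  [Module K N] [Finite ι] {P : RootPairing ι K M N} [P.IsCrystallographic] (b : P.Base)

/-- The simple roots can be numbered so that the Cartan matrix is that of type `A`. -/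
def HasCartanMatrixA : Prop :=
  ∃ (n : ℕ) (e : b.support ≃ Fin n), ∀ i j, b.cartanMatrix i j = CartanMatrix.A n (e i) (e j)

/-- The Dynkin diagram, without arrowheads and multiplicities of edges. -/
def dynkinGraph : SimpleGraph b.support where
  Adj i j := i ≠ j ∧ b.cartanMatrix i j ≠ 0
  symm := ⟨fun _ _ h => ⟨h.1.symm, fun h0 => h.2 (b.cartanMatrix_apply_eq_zero_iff_symm.1 h0)⟩⟩
  loopless := ⟨fun _ h => h.1 rfl⟩

variable {b}

theorem cartanMatrix_le_neg_one {i j : b.support} (h : (dynkinGraph b).Adj i j) :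
    b.cartanMatrix i j ≤ -1 := by
  have hle := b.cartanMatrix_le_zero_of_ne i j h.1
  have hne := h.2
  omega

theorem connected_dynkinGraph [P.IsRootSystem] [P.IsReduced] [P.IsIrreducible] :
    (dynkinGraph b).Connected := by
  have : Nonempty b.support := by
    obtain ⟨θ, -, hθ⟩ := exists_isHighest_and_isAddMaximal (b := b)
    obtain ⟨d, hd, -⟩ := hθ.1.exists_mem_support_pos_pairingIn
    exact ⟨⟨d, hd⟩⟩
  refine ⟨fun i j => b.induction_on_cartanMatrix ((dynkinGraph b).Reachable i) (.refl i) ?_⟩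
  intro j k hj hkj
  rcases eq_or_ne j k with rfl | hjk
  · exact hj
  · exact hj.trans (SimpleGraph.Adj.reachable (G := dynkinGraph b)
      ⟨hjk, fun h => hkj (b.cartanMatrix_apply_eq_zero_iff_symm.1 h)⟩)

variable [P.IsRootSystem]

theorem pairingIn_neg_of_repr_eq_indicator {i : ι} {T : Set b.support} [DecidablePred (· ∈ T)]
    (hi : ∀ d, b.toWeightBasis.repr (P.root i) d = if d ∈ T then 1 else 0) {u v : b.support}
    (hu : u ∈ T) (hv : v ∉ T) (huv : (dynkinGraph b).Adj u v) : P.pairingIn ℤ i v < 0 := by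
  classical
  rw [pairingIn_eq_sum (n := fun d => if d ∈ T then 1 else 0) (by simpa using hi)]
  refine Finset.sum_neg' (fun d _ => ?_) ⟨u, Finset.mem_univ _, ?_⟩
  · split_ifs with hd
    · rw [Nat.cast_one, one_mul]
      exact b.cartanMatrix_le_zero_of_ne d v fun h => hv (h ▸ hd)
    · simp
  · have : P.pairingIn ℤ u v ≤ -1 := cartanMatrix_le_neg_one huv
    simp only [hu, if_true, Nat.cast_one, one_mul]
    omega

open Classical in
theorem exists_repr_eq_indicator {S : Set b.support} (hS : ((dynkinGraph b).induce S).Connected) :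
    ∃ i, b.IsPos i ∧ ∀ d, b.toWeightBasis.repr (P.root i) d = if d ∈ S then 1 else 0 := by
  let F : Set (Set b.support) := {T | T ⊆ S ∧ T.Nonempty ∧
    ∃ i, b.IsPos i ∧ ∀ d, b.toWeightBasis.repr (P.root i) d = if d ∈ T then 1 else 0}
  have hF : F.Nonempty := by
    obtain ⟨s⟩ := hS.nonempty
    exact ⟨{s.1}, by simp, by simp, s.1, b.isPos_of_mem_support s.1.2, fun d => by
      simp [b.toWeightBasis_repr_root, Finsupp.single_apply, eq_comm]⟩
  obtain ⟨T, ⟨hTS, ⟨t, ht⟩, i, hi, hiT⟩, hmax⟩ :=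
    Set.exists_max_image F Set.ncard (Set.toFinite F) hF
  suffices T = S from ⟨i, hi, this ▸ hiT⟩
  by_contra hne
  obtain ⟨s, hs, hsT⟩ := Set.exists_of_ssubset (hTS.ssubset_of_ne hne)
  obtain ⟨p⟩ := hS.preconnected ⟨t, hTS ht⟩ ⟨s, hs⟩
  obtain ⟨⟨⟨u, v⟩, huv⟩, -, hu, hv⟩ := p.exists_boundary_dart {x | x.1 ∈ T} ht hsT
  replace hv : v.1 ∉ T := hv
  obtain ⟨k, hk⟩ := P.root_add_root_mem_of_pairingIn_neg
    (pairingIn_neg_of_repr_eq_indicator hiT hu hv huv)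
    (root_ne_neg_of_isPos hi (b.isPos_of_mem_support v.1.2))
  have hinsert : insert v.1 T ∈ F := by
    refine ⟨Set.insert_subset v.2 hTS, ⟨v, by simp⟩, k,
      hi.add (b.isPos_of_mem_support v.1.2) hk, fun d => ?_⟩
    rw [hk, map_add, Finsupp.add_apply, hiT, b.toWeightBasis_repr_root]
    rcases eq_or_ne d v.1 with rfl | hdv
    · simpa using hv
    · simp [hdv]
  have := hmax _ hinsert
  rw [Set.ncard_insert_of_notMem hv] at this
  omega

end DynkinDiagram

section TypeA

open Module RootPairing

variable {ι K M N : Type*} [Field K] [CharZero K] [AddCommGroup M] [Module K M] [AddCommGroup N]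
  [Module K N] [Finite ι] {P : RootPairing ι K M N} [P.IsCrystallographic] [P.IsRootSystem]
  {b : P.Base}

theorem pairingIn_add_sum_le {i : ι} {n : b.support → ℕ}
    (hn : ∀ d, b.toWeightBasis.repr (P.root i) d = n d) {j : b.support} {s : Finset b.support}
    (hs : ∀ d ∈ s, (dynkinGraph b).Adj j d) :
    P.pairingIn ℤ i j + ∑ d ∈ s, (n d : ℤ) ≤ 2 * n j := by
  classical
  have hterm : ∀ d : b.support, n d * P.pairingIn ℤ d j ≤
      (if d = j then 2 * (n d : ℤ) else 0) - if d ∈ s then (n d : ℤ) else 0 := fun d => by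
    rcases eq_or_ne d j with rfl | hdj
    · have hd : d ∉ s := fun h => (hs d h).ne rfl
      simp [hd, mul_comm]
    · by_cases hds : d ∈ s
      · have hle : P.pairingIn ℤ d j ≤ -1 := cartanMatrix_le_neg_one (hs d hds).symm
        simp only [hdj, hds, if_true, if_false]
        nlinarith
      · have hle : P.pairingIn ℤ d j ≤ 0 := b.cartanMatrix_le_zero_of_ne d j hdj
        simpa [hdj, hds] using mul_nonpos_of_nonneg_of_nonpos (Nat.cast_nonneg (n d)) hle
  have hsum := Finset.sum_le_sum fun d (_ : d ∈ Finset.univ) => hterm d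
  rw [← pairingIn_eq_sum hn, Finset.sum_sub_distrib, Finset.sum_ite_eq' _ j,
    Finset.sum_ite_mem, Finset.univ_inter, if_pos (Finset.mem_univ j)] at hsum
  linarith

namespace IsAddMaximal

variable {θ : ι} {n : b.support → ℕ}

theorem sum_le (hθ : IsAddMaximal b θ) (hn : ∀ d, b.toWeightBasis.repr (P.root θ) d = n d)
    {j : b.support} {s : Finset b.support} (hs : ∀ d ∈ s, (dynkinGraph b).Adj j d) :
    ∑ d ∈ s, n d ≤ 2 * n j := by
  have hle := pairingIn_add_sum_le hn hs
  have hnonneg := hθ.pairingIn_nonneg (b.isPos_of_mem_support j.2)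
  zify
  omega

theorem exists_forall_adj_eq (hθ : IsAddMaximal b θ)
    (hn : ∀ d, b.toWeightBasis.repr (P.root θ) d = n d) (hone : ∀ d, n d = 1) :
    ∃ j, ∀ u v, (dynkinGraph b).Adj j u → (dynkinGraph b).Adj j v → u = v := by
  classical
  obtain ⟨j, hj, hpos⟩ := hθ.1.exists_mem_support_pos_pairingIn
  rw [P.zero_lt_pairingIn_iff'] at hpos
  refine ⟨⟨j, hj⟩, fun u v hu hv => ?_⟩
  by_contra huv
  have hle := pairingIn_add_sum_le hn (j := ⟨j, hj⟩) (s := {u, v}) (by simp [hu, hv])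
  simp only [Finset.sum_pair huv, hone] at hle
  omega

variable [P.IsReduced] [P.IsIrreducible]

theorem coeff_pos (hθ : IsAddMaximal b θ) (hn : ∀ d, b.toWeightBasis.repr (P.root θ) d = n d)
    (d : b.support) : 0 < n d :=
  Nat.pos_of_ne_zero fun h => hθ.repr_ne_zero d (by rw [hn, h, Nat.cast_zero])

theorem coeff_eq_one_of_adj (hθ : IsAddMaximal b θ)
    (hn : ∀ d, b.toWeightBasis.repr (P.root θ) d = n d) {j u v : b.support} (hj : n j = 1)
    (hu : (dynkinGraph b).Adj j u) (hv : (dynkinGraph b).Adj j v) (huv : u ≠ v) : n u = 1 := by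
  classical
  have hle := hθ.sum_le hn (j := j) (s := {u, v}) (by simp [hu, hv])
  rw [Finset.sum_pair huv] at hle
  have := hθ.coeff_pos hn u
  have := hθ.coeff_pos hn v
  omega

theorem eq_or_eq_or_eq_of_adj (hθ : IsAddMaximal b θ)
    (hn : ∀ d, b.toWeightBasis.repr (P.root θ) d = n d) {j u v w : b.support} (hj : n j = 1)
    (hu : (dynkinGraph b).Adj j u) (hv : (dynkinGraph b).Adj j v) (hw : (dynkinGraph b).Adj j w) :
    u = v ∨ u = w ∨ v = w := by
  classical
  by_contra! hne
  have hle := hθ.sum_le hn (j := j) (s := {u, v, w}) (by simp [hu, hv, hw])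
  rw [Finset.sum_insert (by simp [hne]), Finset.sum_pair hne.2.2] at hle
  have := hθ.coeff_pos hn u
  have := hθ.coeff_pos hn v
  have := hθ.coeff_pos hn w
  omega

theorem coeff_eq_one (hθ : IsAddMaximal b θ)
    (hn : ∀ d, b.toWeightBasis.repr (P.root θ) d = n d) {j u v : b.support} (hj : n j = 1)
    (hu : (dynkinGraph b).Adj j u) (hv : (dynkinGraph b).Adj j v) (huv : u ≠ v) (d : b.support) :
    n d = 1 := by
  suffices n d = 1 ∧ ∀ e, (dynkinGraph b).Adj d e → n e = 1 from this.1
  refine b.induction_on_cartanMatrix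
    (fun d => n d = 1 ∧ ∀ e, (dynkinGraph b).Adj d e → n e = 1) (i := j) ⟨hj, fun e he => ?_⟩ ?_
  · rcases eq_or_ne e u with rfl | heu
    · exact hθ.coeff_eq_one_of_adj hn hj hu hv huv
    · exact hθ.coeff_eq_one_of_adj hn hj he hu heu
  · rintro i d ⟨hi, hi'⟩ hdi
    rcases eq_or_ne d i with rfl | hne
    · exact ⟨hi, hi'⟩
    · have hadj : (dynkinGraph b).Adj d i := ⟨hne, hdi⟩
      refine ⟨hi' d hadj.symm, fun e he => ?_⟩
      rcases eq_or_ne e i with rfl | hei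
      · exact hi
      · exact hθ.coeff_eq_one_of_adj hn (hi' d hadj.symm) he hadj hei

end IsAddMaximal

theorem IsHighest.cartanMatrix_eq_neg_one {θ : ι} (hθ : IsHighest b θ)
    {i j : b.support} (hj : b.toWeightBasis.repr (P.root θ) j = 1)
    (hij : (dynkinGraph b).Adj i j) : b.cartanMatrix i j = -1 := by
  have hroot : P.root (P.reflectionPerm j i) =
      P.root i - (b.cartanMatrix i j : K) • P.root j := by
    rw [P.root_reflectionPerm, P.reflection_apply_root, ← P.algebraMap_pairingIn ℤ]
    rfl
  obtain ⟨m, hm⟩ := exists_nat_repr_of_mem_closure (hθ (P.reflectionPerm j i)) j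
  have hcoeff : 1 + (b.cartanMatrix i j : K) = m := by
    simpa [hroot, hj, b.toWeightBasis_repr_root, hij.1] using hm
  have hcoeff' : 1 + b.cartanMatrix i j = m := by exact_mod_cast hcoeff
  have := cartanMatrix_le_neg_one hij
  omega

variable [P.IsReduced] [P.IsIrreducible]

theorem hasCartanMatrixA_of_adj {θ : ι} (hθ : IsHighest b θ) (hθ' : IsAddMaximal b θ)
    {d u v : b.support} (hd : b.toWeightBasis.repr (P.root θ) d = 1)
    (hu : (dynkinGraph b).Adj d u) (hv : (dynkinGraph b).Adj d v) (huv : u ≠ v) :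
    HasCartanMatrixA b := by
  classical
  obtain ⟨n, hn⟩ := exists_nat_repr_root hθ'.1
  have hone : ∀ e, n e = 1 :=
    hθ'.coeff_eq_one hn (by exact_mod_cast (hn d).symm.trans hd) hu hv huv
  obtain ⟨v₀, hv₀⟩ := hθ'.exists_forall_adj_eq hn hone
  obtain ⟨e⟩ := nonempty_iso_pathGraph connected_dynkinGraph hv₀
    fun x _ _ _ => hθ'.eq_or_eq_or_eq_of_adj hn (hone x)
  refine ⟨_, e.toEquiv, fun i j => ?_⟩
  rcases eq_or_ne i j with rfl | hij
  · simp [CartanMatrix.A]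
  · have hadj : (e i).val + 1 = (e j).val ∨ (e j).val + 1 = (e i).val ↔ (dynkinGraph b).Adj i j :=
      SimpleGraph.pathGraph_adj.symm.trans e.map_adj_iff
    have hcart : b.cartanMatrix i j = if (dynkinGraph b).Adj i j then -1 else 0 := by
      split_ifs with h
      · exact hθ.cartanMatrix_eq_neg_one (by rw [hn, hone, Nat.cast_one]) h
      · by_contra h0
        exact h ⟨hij, h0⟩
    simp [CartanMatrix.A, hij, hadj, hcart]

end TypeA

section ThreeDeletedRoots

open Module RootPairing

theorem exists_lt_lt_of_two_lt_ncard {α : Type*} [Finite α] {f : α → ℤ} {T : Set α}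
    (hf : T.InjOn f) (hT : 2 < T.ncard) :
    ∃ x ∈ T, ∃ y ∈ T, ∃ z ∈ T, f x < f y ∧ f y < f z := by
  have hne : T.Nonempty := Set.nonempty_of_ncard_ne_zero (by omega)
  obtain ⟨x, hx, hmin⟩ := Set.exists_min_image T f T.toFinite hne
  obtain ⟨z, hz, hmax⟩ := Set.exists_max_image T f T.toFinite hne
  obtain ⟨y, hy, hyxz⟩ := Set.exists_mem_notMem_of_ncard_lt_ncard
    (((Set.ncard_insert_le x {z}).trans (by simp)).trans_lt hT)
  simp only [Set.mem_insert_iff, Set.mem_singleton_iff, not_or] at hyxz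
  exact ⟨x, hx, y, hy, z, hz, (hmin y hy).lt_of_ne fun h => hyxz.1 (hf hy hx h.symm),
    (hmax y hy).lt_of_ne fun h => hyxz.2 (hf hy hz h)⟩

variable {ι K M N : Type*} [Field K] [CharZero K] [AddCommGroup M] [Module K M] [AddCommGroup N]
  [Module K N] [Finite ι] {P : RootPairing ι K M N} [P.IsCrystallographic] [P.IsRootSystem]
  {b : P.Base} {S : Set ι} {V : Type*} [DecidableEq V] [Finite V]
  {A : ArrowLabelling V P (Submodule.span K (P.root '' S))}

namespace ArrowLabelling

variable [P.IsIrreducible]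

theorem repr_root_of_isPos (hS : S ⊆ b.support) {w : V → ℤ}
    (hw : Function.Injective w) (hstep : ∀ d ∈ b.support, d ∉ S → w (A.tgt d) = w (A.src d) + 1)
    {i : ι} (hi : b.IsPos i) {d : b.support} (hd : d.1 ∉ S) :
    b.toWeightBasis.repr (P.root i) d =
      if w (A.src i) ≤ w (A.src d) ∧ w (A.src d) < w (A.tgt i) then 1 else 0 := by
  have hrepr := A.repr_root_eq hS hw hstep i hd
  obtain ⟨n, hn⟩ := exists_nat_repr_root hi
  rw [hn, ← Int.cast_natCast, Int.cast_inj] at hrepr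
  rw [hn]
  split_ifs at hrepr ⊢ <;> norm_cast <;> omega

variable [P.IsReduced]

theorem IsFull.repr_isAddMaximal (hA : A.IsFull) (hS : S ⊆ b.support) {θ : ι}
    (hθ : IsAddMaximal b θ) {d : b.support} (hd : d.1 ∉ S) :
    b.toWeightBasis.repr (P.root θ) d = 1 := by
  obtain ⟨w, hw, hstep⟩ := hA.exists_injective_int hS
  have hrepr := A.repr_root_of_isPos hS hw hstep hθ.1 hd
  have hne := hθ.repr_ne_zero d
  split_ifs at hrepr
  · exact hrepr
  · contradiction

-- The highest root has coefficient one at the middle of three deleted simple roots. This node is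
-- not a leaf: the sum of all other simple roots would be a root, contradicting convexity.
theorem IsFull.hasCartanMatrixA (hA : A.IsFull) (hS : S ⊆ b.support)
    (hcard : 2 < {d : b.support | d.1 ∉ S}.ncard) : HasCartanMatrixA b := by
  classical
  obtain ⟨w, hw, hstep⟩ := hA.exists_injective_int hS
  have hrepr : ∀ i, b.IsPos i → ∀ d : b.support, d.1 ∉ S → _ := fun i hi d hd =>
    A.repr_root_of_isPos hS hw hstep hi hd
  have hinj : Set.InjOn (fun d : b.support => w (A.src d)) {d | d.1 ∉ S} := fun d hd e he h => by
    have hd' := hrepr e (b.isPos_of_mem_support e.2) d hd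
    by_contra hne
    have := hstep e e.2 he
    simp only at h
    simp [b.toWeightBasis_repr_root, Ne.symm hne, h, this] at hd'
  obtain ⟨d₁, hd₁, d₂, hd₂, d₃, hd₃, h₁₂, h₂₃⟩ := exists_lt_lt_of_two_lt_ncard hinj hcard
  have hne₁ : d₁ ≠ d₂ := fun h => h₁₂.ne (by rw [h])
  have hne₃ : d₃ ≠ d₂ := fun h => h₂₃.ne (by rw [h])
  obtain ⟨θ, hθ, hθ'⟩ := exists_isHighest_and_isAddMaximal (b := b)
  have : Nontrivial b.support := ⟨_, _, hne₁⟩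
  obtain ⟨u, hu⟩ := connected_dynkinGraph.preconnected.exists_adj_of_nontrivial d₂
  by_contra hA'
  have hleaf : ∀ v, (dynkinGraph b).Adj d₂ v → v = u := fun v hv => by
    by_contra hvu
    exact hA' (hasCartanMatrixA_of_adj hθ hθ' (hA.repr_isAddMaximal hS hθ' hd₂) hv hu hvu)
  have hconn : ((dynkinGraph b).induce {d₂}ᶜ).Connected :=
    connected_dynkinGraph.induce_compl_singleton_of_degree_eq_one
      (SimpleGraph.degree_eq_one_iff_existsUnique_adj.2 ⟨u, hu, hleaf⟩)
  obtain ⟨i, hi, hind⟩ := exists_repr_eq_indicator hconn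
  have hconvex : ∀ d : b.support, d.1 ∉ S →
      (w (A.src i) ≤ w (A.src d) ∧ w (A.src d) < w (A.tgt i) ↔ d ≠ d₂) := fun d hd => by
    have hd' := (hind d).symm.trans (hrepr i hi d hd)
    rw [Set.mem_compl_singleton_iff] at hd'
    split_ifs at hd' <;> simp_all
  have h₁ := (hconvex d₁ hd₁).2 hne₁
  have h₃ := (hconvex d₃ hd₃).2 hne₃
  exact (hconvex d₂ hd₂).1 ⟨by omega, by omega⟩ rfl

end ArrowLabelling

end ThreeDeletedRoots

section Differences

open Module RootPairing

variable {ι K M N : Type*} [Field K] [AddCommGroup M] [Module K M] [AddCommGroup N] [Module K N]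

theorem sub_smul_single_eq_comp_swap {V : Type*} [DecidableEq V] {c d : V} (hcd : c ≠ d)
    (v : V → K) :
    v - (v c - v d) • (Pi.single c 1 - Pi.single d 1) = v ∘ Equiv.swap c d := by
  ext x
  simp only [Pi.sub_apply, Pi.smul_apply, smul_eq_mul, Function.comp_apply]
  rcases eq_or_ne x c with rfl | hxc
  · simp [hcd]
  rcases eq_or_ne x d with rfl | hxd
  · simp [hcd.symm]
  · simp [hxc, hxd, Equiv.swap_apply_of_ne_of_ne hxc hxd]

theorem single_comp_swap {V : Type*} [DecidableEq V] (c d s : V) :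
    (Pi.single s 1 : V → K) ∘ Equiv.swap c d = Pi.single (Equiv.swap c d s) 1 := by
  ext x
  simp only [Function.comp_apply, Pi.single_apply, Equiv.swap_apply_eq_iff]

variable {P : RootPairing ι K M N} [P.IsRootSystem] {b : P.Base}

theorem eq_zero_of_forall_coroot'_eq_zero {x : M} (hx : ∀ j : b.support, P.coroot' j x = 0) :
    x = 0 := by
  refine P.toLinearMap.toPerfPair.injective (b.flip.toWeightBasis.ext fun j => ?_)
  rw [map_zero, LinearMap.zero_apply, b.flip.toWeightBasis_apply]
  exact hx j

/-- Sends the simple roots to `e₀ - e₁`, …, `e_{n-1} - e_n`, according to the numbering `e`. -/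
noncomputable def toDifferences (b : P.Base) {n : ℕ} (e : b.support ≃ Fin n) :
    M →ₗ[K] Fin (n + 1) → K :=
  b.toWeightBasis.constr K fun d => Pi.single (e d).castSucc 1 - Pi.single (e d).succ 1

section

variable {n : ℕ} (e : b.support ≃ Fin n)

theorem toDifferences_root (d : b.support) :
    toDifferences b e (P.root d) = Pi.single (e d).castSucc 1 - Pi.single (e d).succ 1 := by
  rw [← b.toWeightBasis_apply]
  exact b.toWeightBasis.constr_basis K _ d

variable {e} [P.IsCrystallographic]
  (he : ∀ i j, b.cartanMatrix i j = CartanMatrix.A n (e i) (e j))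
include he

theorem coroot'_eq_toDifferences_sub (j : b.support) (x : M) :
    P.coroot' j x = toDifferences b e x (e j).castSucc - toDifferences b e x (e j).succ := by
  suffices P.coroot' j = ((LinearMap.proj (e j).castSucc : (Fin (n + 1) → K) →ₗ[K] K) -
      LinearMap.proj (e j).succ) ∘ₗ toDifferences b e from LinearMap.congr_fun this x
  refine b.toWeightBasis.ext fun d => ?_
  rw [b.toWeightBasis_apply, P.root_coroot'_eq_pairing, LinearMap.comp_apply, toDifferences_root,
    show P.pairing d j = ((b.cartanMatrix d j : ℤ) : K) from (P.algebraMap_pairingIn ℤ d j).symm,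
    he d j]
  simp only [CartanMatrix.A, Matrix.of_apply, LinearMap.sub_apply, LinearMap.proj_apply,
    Pi.sub_apply, Pi.single_apply, Fin.ext_iff, Fin.val_castSucc, Fin.val_succ]
  split_ifs <;> first | omega | norm_num

theorem ker_toDifferences : LinearMap.ker (toDifferences b e) = ⊥ := by
  refine (LinearMap.ker_eq_bot').2 fun x hx =>
    eq_zero_of_forall_coroot'_eq_zero (b := b) fun j => ?_
  simp [coroot'_eq_toDifferences_sub he, hx]

theorem exists_toDifferences_root_eq [CharZero K] [Finite ι] [P.IsReduced] (i : ι) :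
    ∃ t s, toDifferences b e (P.root i) = Pi.single t 1 - Pi.single s 1 := by
  refine b.induction_reflect i
    (p := fun i => ∃ t s, toDifferences b e (P.root i) = Pi.single t 1 - Pi.single s 1) ?_ ?_ ?_
  · rintro i ⟨t, s, h⟩
    exact ⟨s, t, by rw [P.root_reflectionPerm, P.reflection_apply_self, map_neg, h, neg_sub]⟩
  · exact fun i hi => ⟨_, _, toDifferences_root e ⟨i, hi⟩⟩
  · rintro i j ⟨t, s, h⟩ hj
    set c := (e ⟨j, hj⟩).castSucc with hc
    set d := (e ⟨j, hj⟩).succ with hd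
    have hcd : c ≠ d := by simp [hc, hd, Fin.ext_iff]
    have hreflect : toDifferences b e (P.root (P.reflectionPerm j i)) =
        toDifferences b e (P.root i) ∘ Equiv.swap c d := by
      rw [P.root_reflectionPerm, P.reflection_apply, map_sub, map_smul,
        coroot'_eq_toDifferences_sub he ⟨j, hj⟩, toDifferences_root e ⟨j, hj⟩,
        sub_smul_single_eq_comp_swap hcd]
    refine ⟨Equiv.swap c d t, Equiv.swap c d s, ?_⟩
    rw [hreflect, h, ← single_comp_swap, ← single_comp_swap]
    rfl

end

theorem HasCartanMatrixA.exists_isQuadraticPair [CharZero K] [Finite ι] [P.IsCrystallographic]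
    [P.IsReduced] (hb : HasCartanMatrixA b)
    (l : Dual K M) : ∃ m, IsQuadraticPair P l m := by
  obtain ⟨n, e, he⟩ := hb
  exact exists_isQuadraticPair_of_ker_le (toDifferences b e) (exists_toDifferences_root_eq he)
    (by simp [ker_toDifferences he])

end Differences

section Existence

open Module RootPairing

variable {ι K M N : Type*} [Field K] [CharZero K] [AddCommGroup M] [Module K M] [AddCommGroup N]
  [Module K N] {P : RootPairing ι K M N}

theorem IsTypeAQuotient.exists_isQuadraticPair {V : Type*} [Finite V] [DecidableEq V] [Nonempty V]
    {Q : Submodule K M} (h : IsTypeAQuotient P Q V) {l : Dual K M} (hl : Q ≤ LinearMap.ker l) :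
    ∃ m, IsQuadraticPair P l m := by
  obtain ⟨e, he⟩ := h
  refine exists_isQuadraticPair_of_ker_le (Submodule.subtype _ ∘ₗ e.toLinearMap ∘ₗ Q.mkQ)
    (fun i => ?_) fun x hx => hl ?_
  · by_cases hi : Q.mkQ (P.root i) = 0
    · obtain ⟨v⟩ := ‹Nonempty V›
      exact ⟨v, v, by simp only [LinearMap.comp_apply, hi, map_zero, sub_self]⟩
    · obtain ⟨t, s, -, h⟩ := he.le ⟨_, ⟨hi, i, rfl⟩, rfl⟩
      exact ⟨t, s, h⟩
  · simpa using hx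

variable [Finite ι] [P.IsCrystallographic] [P.IsRootSystem] {b : P.Base}

theorem exists_isQuadraticPair_of_isHighest {S : Set ι} {l : Dual K M}
    (hl : ∀ i ∈ S, l (P.root i) = 0) {θ : ι} (hθ : IsHighest b θ) {d d' : b.support}
    (hS : ∀ i : b.support, i.1 ∉ S → i = d ∨ i = d')
    (hd : b.toWeightBasis.repr (P.root θ) d = 1) (hd' : b.toWeightBasis.repr (P.root θ) d' = 1) :
    ∃ m, IsQuadraticPair P l m := by
  classical
  set f : Dual K M := b.toWeightBasis.coord d with hf
  set f' : Dual K M := if d = d' then 0 else b.toWeightBasis.coord d' with hf'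
  let F : M →ₗ[K] (Fin 3 → K) := f.smulRight (Pi.single 0 1 - Pi.single 1 1) +
    f'.smulRight (Pi.single 1 1 - Pi.single 2 1)
  have hFpos : ∀ i, b.IsPos i → ∃ t s : Fin 3, F (P.root i) = Pi.single t 1 - Pi.single s 1 := by
    intro i hi
    have h : f (P.root i) = 0 ∨ f (P.root i) = 1 := hθ.repr_of_isPos hd hi
    have h' : f' (P.root i) = 0 ∨ f' (P.root i) = 1 := by
      by_cases hdd : d = d'
      · exact Or.inl (by simp [hf', hdd])
      · rw [hf', if_neg hdd]
        exact hθ.repr_of_isPos hd' hi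
    obtain ⟨h | h, h' | h'⟩ := And.intro h h'
    · exact ⟨0, 0, by simp [F, h, h']⟩
    · exact ⟨1, 2, by simp [F, h, h']⟩
    · exact ⟨0, 1, by simp [F, h, h']⟩
    · exact ⟨0, 2, by simp [F, h, h']⟩
  refine exists_isQuadraticPair_of_ker_le F (fun i => ?_) fun x hx => ?_
  · rcases isPos_or_exists_isPos_root_eq_neg (b := b) i with hi | ⟨j, hj, hji⟩
    · exact hFpos i hi
    · obtain ⟨t, s, hts⟩ := hFpos j hj
      exact ⟨s, t, by rw [← neg_neg (P.root i), ← hji, map_neg, hts, neg_sub]⟩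
  · have h0 : f x = 0 := by simpa [F] using congrFun (LinearMap.mem_ker.1 hx) 0
    have h2 : f' x = 0 := by simpa [F] using congrFun (LinearMap.mem_ker.1 hx) 2
    have hrepr : ∀ i : b.support, i.1 ∉ S → b.toWeightBasis.repr x i = 0 := fun i hi => by
      rcases hS i hi with rfl | rfl
      · exact h0
      · by_cases hdd : d = i
        · exact hdd ▸ h0
        · rwa [hf', if_neg hdd] at h2
    rw [LinearMap.mem_ker, ← b.toWeightBasis.sum_repr x, map_sum]
    refine Finset.sum_eq_zero fun i _ => ?_
    by_cases hi : i.1 ∈ S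
    · rw [map_smul, b.toWeightBasis_apply, hl i hi, smul_zero]
    · rw [hrepr i hi, zero_smul, map_zero]

theorem exists_isQuadraticPair_of_ncard_diff {S : Set ι} {l : Dual K M}
    (hl : ∀ i ∈ S, l (P.root i) = 0)
    (hcard : ((b.support : Set ι) \ S).ncard = 1 ∨ ((b.support : Set ι) \ S).ncard = 2)
    {θ : ι} (hθ : IsHighest b θ)
    (hone : ∀ d : b.support, d.1 ∉ S → b.toWeightBasis.repr (P.root θ) d = 1) :
    ∃ m, IsQuadraticPair P l m := by
  obtain ⟨d, d', hd⟩ : ∃ d d', (b.support : Set ι) \ S = {d, d'} := by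
    rcases hcard with h | h
    · obtain ⟨d, hd⟩ := Set.ncard_eq_one.1 h
      exact ⟨d, d, by simp [hd]⟩
    · obtain ⟨d, d', -, hd⟩ := Set.ncard_eq_two.1 h
      exact ⟨d, d', hd⟩
  obtain ⟨hd₁, hd₁'⟩ : d ∈ (b.support : Set ι) \ S ∧ d' ∈ (b.support : Set ι) \ S := by simp [hd]
  exact exists_isQuadraticPair_of_isHighest hl hθ (d := ⟨d, hd₁.1⟩) (d' := ⟨d', hd₁'.1⟩)
    (fun i hi => by simpa [Subtype.ext_iff] using hd.le ⟨i.2, hi⟩) (hone _ hd₁.2) (hone _ hd₁'.2)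

variable {S : Set ι} {l m : Dual K M}

theorem IsQuadraticPair.exists_isTypeAQuotient [P.IsIrreducible] (h : IsQuadraticPair P l m)
    (b : P.Base) (hl : ∀ i, P.root i ∈ Submodule.span K (P.root '' S) ↔ l (P.root i) = 0) :
    ∃ k : ℕ, IsTypeAQuotient P (Submodule.span K (P.root '' S)) (Fin (k + 1)) := by
  classical
  obtain ⟨A⟩ := h.nonempty_arrowLabelling b hl
  obtain ⟨k, B, hB⟩ := A.exists_isFull_fin
  exact ⟨k, hB.isTypeAQuotient⟩

theorem IsQuadraticPair.ncard_diff_and_exists_isHighest [P.IsReduced] [P.IsIrreducible]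
    (h : IsQuadraticPair P l m) (hS : S ⊂ b.support)
    (hl : ∀ i, P.root i ∈ Submodule.span K (P.root '' S) ↔ l (P.root i) = 0)
    (hb : ¬ HasCartanMatrixA b) :
    (((b.support : Set ι) \ S).ncard = 1 ∨ ((b.support : Set ι) \ S).ncard = 2) ∧
      ∃ θ, IsHighest b θ ∧
        ∀ d : b.support, d.1 ∉ S → b.toWeightBasis.repr (P.root θ) d = 1 := by
  classical
  obtain ⟨A⟩ := h.nonempty_arrowLabelling b hl
  obtain ⟨k, B, hB⟩ := A.exists_isFull_fin
  constructor
  · have hcard : ((b.support : Set ι) \ S).ncard ≤ 2 := by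
      rw [← show Subtype.val '' {d : b.support | d.1 ∉ S} = (b.support : Set ι) \ S from
        Subtype.image_preimage_coe _ Sᶜ, Set.ncard_image_of_injective _ Subtype.val_injective]
      exact le_of_not_gt fun hlt => hb (hB.hasCartanMatrixA hS.le hlt)
    have hpos : 0 < ((b.support : Set ι) \ S).ncard :=
      (Set.ncard_pos (Set.toFinite _)).2 (Set.nonempty_of_ssubset hS)
    omega
  · obtain ⟨θ, hθ, hθ'⟩ := exists_isHighest_and_isAddMaximal (b := b)
    exact ⟨θ, hθ, fun d hd => hB.repr_isAddMaximal hS.le hθ' hd⟩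

end Existence

section Evaluation

open Module ExteriorAlgebra
open scoped ExteriorAlgebra

variable {R M N : Type*} [CommRing R] [AddCommGroup M] [Module R M] [AddCommGroup N] [Module R N]
  {n : ℕ}

/-- The value of the component of degree `n` of a polyvector on `n` covectors. -/
noncomputable def evalCovectors (d : Fin n → Dual R M) : ExteriorAlgebra R M →ₗ[R] R :=
  liftAlternating
    (Pi.single n ((exteriorPower.pairingDual R M n (exteriorPower.ιMulti R n d)).compAlternatingMap
      (exteriorPower.ιMulti R n)))

theorem evalCovectors_coe (d : Fin n → Dual R M) (w : ⋀[R]^n M) :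
    evalCovectors d w = exteriorPower.pairingDual R M n (exteriorPower.ιMulti R n d) w := by
  suffices evalCovectors d ∘ₗ Submodule.subtype _ =
      exteriorPower.pairingDual R M n (exteriorPower.ιMulti R n d) from LinearMap.congr_fun this w
  ext v
  simp [evalCovectors, liftAlternating_apply_ιMulti]

theorem evalCovectors_ιMulti (d : Fin n → Dual R M) (v : Fin n → M) :
    evalCovectors d (ιMulti R n v) = (Matrix.of fun i j => d j (v i)).det := by
  rw [← exteriorPower.ιMulti_apply_coe, evalCovectors_coe, exteriorPower.pairingDual_ιMulti_ιMulti]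

theorem evalCovectors_map (f : M →ₗ[R] N) (d : Fin n → Dual R N) {w : ExteriorAlgebra R M}
    (hw : w ∈ ⋀[R]^n M) : evalCovectors d (map f w) = evalCovectors (fun i => d i ∘ₗ f) w := by
  suffices evalCovectors d ∘ₗ (map f).toLinearMap ∘ₗ (⋀[R]^n M).subtype =
      evalCovectors (fun i => d i ∘ₗ f) ∘ₗ (⋀[R]^n M).subtype from LinearMap.congr_fun this ⟨w, hw⟩
  ext v
  simp [evalCovectors_ιMulti]

theorem map_mem_exteriorPower (f : M →ₗ[R] N) {w : ExteriorAlgebra R M} (hw : w ∈ ⋀[R]^n M) :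
    map f w ∈ ⋀[R]^n N := by
  have h : (⋀[R]^n M).map (map f).toLinearMap ≤ ⋀[R]^n N := by
    rw [ExteriorAlgebra.exteriorPower, ExteriorAlgebra.exteriorPower, Submodule.map_pow]
    gcongr
    rintro _ ⟨_, ⟨x, rfl⟩, rfl⟩
    exact ⟨f x, (map_apply_ι f x).symm⟩
  exact h ⟨w, hw, rfl⟩

theorem eq_zero_of_forall_evalCovectors [Module.Free R M] {w : ExteriorAlgebra R M}
    (hw : w ∈ ⋀[R]^n M) (h : ∀ d : Fin n → Dual R M, evalCovectors d w = 0) : w = 0 := by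
  lift w to ⋀[R]^n M using hw
  classical
  let : LinearOrder (Module.Free.ChooseBasisIndex R M) := linearOrderOfSTO WellOrderingRel
  let b := (Module.Free.chooseBasis R M).exteriorPower n
  refine congrArg Subtype.val (b.ext_elem (y := 0) fun s => ?_)
  rw [map_zero, Finsupp.zero_apply, exteriorPower.basis_repr_apply, exteriorPower.ιMultiDual,
    exteriorPower.ιMulti_family, ← evalCovectors_coe, h]

theorem evalCovectors_eq_zero_of_mem_span {D : Set (Dual R M)} {w : ExteriorAlgebra R M}
    (hw : w ∈ ⋀[R]^n M) (h : ∀ d : Fin n → Dual R M, (∀ i, d i ∈ D) → evalCovectors d w = 0)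
    {d : Fin n → Dual R M} (hd : ∀ i, d i ∈ Submodule.span R D) : evalCovectors d w = 0 := by
  lift w to ⋀[R]^n M using hw
  let φ : (Dual R M) [⋀^Fin n]→ₗ[R] R :=
    ((exteriorPower.pairingDual R M n).flip w).compAlternatingMap (exteriorPower.ιMulti R n)
  have hφ : ∀ d, evalCovectors d w = φ d := fun d => evalCovectors_coe d w
  simp only [hφ] at h ⊢
  choose k c g hg using fun i => Submodule.mem_span_set'.1 (hd i)
  rw [← funext hg, ← φ.coe_multilinearMap, MultilinearMap.map_sum]
  refine Finset.sum_eq_zero fun r _ => ?_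
  rw [MultilinearMap.map_smul_univ, φ.coe_multilinearMap, h _ fun i => (g i (r i)).2, smul_zero]

theorem evalCovectors_ι_mul_ι (d₁ d₂ : Dual R M) (x y : M) :
    evalCovectors ![d₁, d₂] (ι R x * ι R y) = d₁ x * d₂ y - d₂ x * d₁ y := by
  have h : ι R x * ι R y = ιMulti R 2 ![x, y] := by simp [ιMulti_apply]
  rw [h, evalCovectors_ιMulti, Matrix.det_fin_two]
  rfl

theorem evalCovectors_ι_mul_ι_mul_ι (d₁ d₂ d₃ : Dual R M) (x y z : M) :
    evalCovectors ![d₁, d₂, d₃] (ι R x * ι R y * ι R z) =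
      d₁ x * (d₂ y * d₃ z - d₂ z * d₃ y) - d₁ y * (d₂ x * d₃ z - d₂ z * d₃ x) +
        d₁ z * (d₂ x * d₃ y - d₂ y * d₃ x) := by
  have h : ι R x * ι R y * ι R z = ιMulti R 3 ![x, y, z] := by simp [ιMulti_apply, mul_assoc]
  rw [h, evalCovectors_ιMulti, Matrix.det_fin_three]
  simp
  ring

end Evaluation

section Bivectors

open Module ExteriorAlgebra
open scoped ExteriorAlgebra

variable {L : Type*} [LieRing L] [LieAlgebra ℂ L]

theorem killingForm_comm (x y : L) : killingForm ℂ L x y = killingForm ℂ L y x :=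
  LieModule.traceForm_comm ℂ L L x y

theorem killingForm_lie (x y z : L) : killingForm ℂ L ⁅x, y⁆ z = killingForm ℂ L x ⁅y, z⁆ :=
  LieModule.traceForm_apply_lie_apply ℂ L L x y z

theorem coe_wedge (x y : L) : (wedge x y : ExteriorAlgebra ℂ L) = ι ℂ x * ι ℂ y := by
  simp [wedge, ιMulti_apply]

theorem adBivector_mem (x : L) (f : ⋀[ℂ]^2 L) : adBivector x f ∈ ⋀[ℂ]^2 L := by
  suffices (⋀[ℂ]^2 L).mkQ ∘ₗ adBivector x = 0 from
    (Submodule.Quotient.mk_eq_zero _).1 (LinearMap.congr_fun this f)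
  refine bivector_hom_ext fun y z => ?_
  rw [LinearMap.comp_apply, adBivector_wedge, ← coe_wedge, ← coe_wedge, LinearMap.zero_apply,
    Submodule.mkQ_apply, Submodule.Quotient.mk_eq_zero]
  exact Submodule.add_mem _ (Subtype.mem _) (Subtype.mem _)

theorem schouten_mem (f g : ⋀[ℂ]^2 L) : schouten f g ∈ ⋀[ℂ]^3 L := by
  suffices schouten.compr₂ (⋀[ℂ]^3 L).mkQ = 0 from
    (Submodule.Quotient.mk_eq_zero _).1 (LinearMap.congr_fun₂ this f g)
  have h : ∀ x y z : L, ι ℂ x * ι ℂ y * ι ℂ z ∈ ⋀[ℂ]^3 L := fun x y z => by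
    rw [ExteriorAlgebra.exteriorPower, pow_succ, pow_two]
    exact Submodule.mul_mem_mul (Submodule.mul_mem_mul ⟨x, rfl⟩ ⟨y, rfl⟩) ⟨z, rfl⟩
  refine bivector_hom_ext fun x₁ x₂ => bivector_hom_ext fun y₁ y₂ => ?_
  rw [LinearMap.compr₂_apply, schouten_wedge, LinearMap.zero_apply, LinearMap.zero_apply,
    Submodule.mkQ_apply, Submodule.Quotient.mk_eq_zero]
  exact Submodule.add_mem _ (Submodule.sub_mem _ (Submodule.sub_mem _ (h _ _ _) (h _ _ _))
    (h _ _ _)) (h _ _ _)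

/-- The endomorphism of `L` into which the Killing form turns a bivector, by contraction in the
first factor. -/
noncomputable def toEndo : ⋀[ℂ]^2 L →ₗ[ℂ] L →ₗ[ℂ] L :=
  altLift ((LinearMap.smulRightₗ ∘ₗ killingForm ℂ L) -
    (LinearMap.smulRightₗ ∘ₗ killingForm ℂ L).flip) fun x => by simp

theorem toEndo_wedge (x y a : L) :
    toEndo (wedge x y) a = killingForm ℂ L x a • y - killingForm ℂ L y a • x := by
  simp [toEndo, altLift_wedge]

theorem killingForm_toEndo (f : ⋀[ℂ]^2 L) (a b : L) :
    killingForm ℂ L (toEndo f a) b = -killingForm ℂ L a (toEndo f b) := by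
  suffices (killingForm ℂ L).flip b ∘ₗ toEndo.flip a =
      -(killingForm ℂ L a ∘ₗ toEndo.flip b) from LinearMap.congr_fun this f
  refine bivector_hom_ext fun x y => ?_
  change killingForm ℂ L (toEndo (wedge x y) a) b = -killingForm ℂ L a (toEndo (wedge x y) b)
  simp only [toEndo_wedge, map_sub, map_smul, LinearMap.sub_apply, LinearMap.smul_apply,
    smul_eq_mul, killingForm_comm a]
  ring

theorem evalCovectors_adBivector (x a b : L) (f : ⋀[ℂ]^2 L) :
    evalCovectors ![killingForm ℂ L a, killingForm ℂ L b] (adBivector x f) =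
      killingForm ℂ L (⁅x, toEndo f a⁆ - toEndo f ⁅x, a⁆) b := by
  suffices evalCovectors ![killingForm ℂ L a, killingForm ℂ L b] ∘ₗ adBivector x =
      (killingForm ℂ L).flip b ∘ₗ
        ((LieAlgebra.ad ℂ L x : L →ₗ[ℂ] L) ∘ₗ toEndo.flip a - toEndo.flip ⁅x, a⁆) from
    LinearMap.congr_fun this f
  refine bivector_hom_ext fun y z => ?_
  have h : ∀ u, killingForm ℂ L u ⁅x, a⁆ = -killingForm ℂ L a ⁅x, u⁆ := fun u => by
    rw [← killingForm_lie, ← lie_skew, map_neg, LinearMap.neg_apply, killingForm_comm]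
  change evalCovectors ![killingForm ℂ L a, killingForm ℂ L b] (adBivector x (wedge y z)) =
    killingForm ℂ L (⁅x, toEndo (wedge y z) a⁆ - toEndo (wedge y z) ⁅x, a⁆) b
  simp only [adBivector_wedge, map_add, evalCovectors_ι_mul_ι, toEndo_wedge, map_sub, map_smul,
    lie_sub, lie_smul, h, smul_eq_mul, LinearMap.sub_apply, LinearMap.smul_apply,
    killingForm_comm b, killingForm_comm a y, killingForm_comm a z]
  ring

theorem evalCovectors_schouten (a b c : L) (f g : ⋀[ℂ]^2 L) :
    evalCovectors ![killingForm ℂ L a, killingForm ℂ L b, killingForm ℂ L c] (schouten f g) =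
      killingForm ℂ L (⁅toEndo f a, toEndo g b⁆ + ⁅toEndo g a, toEndo f b⁆) c +
      killingForm ℂ L (⁅toEndo f b, toEndo g c⁆ + ⁅toEndo g b, toEndo f c⁆) a +
      killingForm ℂ L (⁅toEndo f c, toEndo g a⁆ + ⁅toEndo g c, toEndo f a⁆) b := by
  let B (a b c : L) : ⋀[ℂ]^2 L →ₗ[ℂ] ⋀[ℂ]^2 L →ₗ[ℂ] ℂ := LinearMap.mk₂ ℂ
    (fun f g => killingForm ℂ L (⁅toEndo f a, toEndo g b⁆ + ⁅toEndo g a, toEndo f b⁆) c)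
    (by intros; simp; ring) (by intros; simp; ring) (by intros; simp; ring) (by intros; simp; ring)
  suffices schouten.compr₂ (evalCovectors ![killingForm ℂ L a, killingForm ℂ L b,
      killingForm ℂ L c]) = B a b c + B b c a + B c a b from LinearMap.congr_fun₂ this f g
  refine bivector_hom_ext fun x₁ x₂ => bivector_hom_ext fun y₁ y₂ => ?_
  simp only [LinearMap.compr₂_apply, schouten_wedge, map_add, map_sub, LinearMap.add_apply,
    evalCovectors_ι_mul_ι_mul_ι, B, LinearMap.mk₂_apply, toEndo_wedge, sub_lie, lie_sub, smul_lie,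
    lie_smul, LinearMap.sub_apply, map_smul, LinearMap.smul_apply, smul_eq_mul,
    ← lie_skew y₁ x₁, ← lie_skew y₂ x₁, ← lie_skew y₁ x₂, ← lie_skew y₂ x₂, map_neg,
    LinearMap.neg_apply, killingForm_comm a, killingForm_comm b, killingForm_comm c]
  ring

variable [LieAlgebra.IsKilling ℂ L]

theorem eq_zero_of_forall_killingForm {x : L} (h : ∀ y, killingForm ℂ L x y = 0) : x = 0 :=
  (LieAlgebra.IsKilling.killingForm_nondegenerate ℂ L).1 x h

theorem exists_eq_killingForm [FiniteDimensional ℂ L] (d : Dual ℂ L) :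
    ∃ a, d = killingForm ℂ L a :=
  (((killingForm ℂ L).toDual
    (LieAlgebra.IsKilling.killingForm_nondegenerate ℂ L)).surjective d).imp fun _ => Eq.symm

theorem adBivector_eq_zero_iff [FiniteDimensional ℂ L] {x : L} {f : ⋀[ℂ]^2 L} :
    adBivector x f = 0 ↔ ∀ a, ⁅x, toEndo f a⁆ = toEndo f ⁅x, a⁆ := by
  constructor
  · intro h a
    refine sub_eq_zero.1 (eq_zero_of_forall_killingForm fun b => ?_)
    rw [← evalCovectors_adBivector, h, map_zero]
  · refine fun h => eq_zero_of_forall_evalCovectors (adBivector_mem x f) fun d => ?_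
    obtain ⟨a, ha⟩ := exists_eq_killingForm (d 0)
    obtain ⟨b, hb⟩ := exists_eq_killingForm (d 1)
    have hd : d = ![killingForm ℂ L a, killingForm ℂ L b] := by
      rw [← ha, ← hb]
      exact (FinVec.etaExpand_eq d).symm
    rw [hd, evalCovectors_adBivector, h, sub_self, map_zero, LinearMap.zero_apply]

end Bivectors

section RootSpaces

open LieModule LieAlgebra LieAlgebra.IsKilling

variable {K L : Type*} [Field K] [CharZero K] [LieRing L] [LieAlgebra K L] [FiniteDimensional K L]
  [LieAlgebra.IsKilling K L] {H : LieSubalgebra K L} [H.IsCartanSubalgebra]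
  [IsTriangularizable K H L]

theorem exists_eq_smul_of_mem_rootSpace {α : Weight K H L} (hα : α.IsNonZero) {x y : L}
    (hx : x ∈ rootSpace H α) (hx₀ : x ≠ 0) (hy : y ∈ rootSpace H α) : ∃ c : K, y = c • x := by
  obtain ⟨c, hc⟩ := (finrank_eq_one_iff_of_nonzero' (⟨x, hx⟩ : rootSpace H α)
    fun h => hx₀ (congrArg Subtype.val h)).1 (finrank_rootSpace_eq_one α hα) ⟨y, hy⟩
  exact ⟨c, (congrArg Subtype.val hc).symm⟩

theorem chainTopCoeff_neg_lt_chainLength {α β : Weight K H L} (hα : α.IsNonZero)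
    (h : rootSpace H (α + β) ≠ ⊥) : chainTopCoeff (-α) β < chainLength (-α) β := by
  have hbot : (1 : ℤ) ≤ chainBotCoeff (-α) β :=
    le_chainBotCoeff_of_rootSpace_ne_top (-α) β hα.neg 1 (by simpa using h)
  have := chainTopCoeff_add_chainBotCoeff (-α) β
  lia

theorem lie_ne_zero_of_mem_rootSpace {α β : Weight K H L} (hα : α.IsNonZero) (hβ : β.IsNonZero)
    (h : rootSpace H (α + β) ≠ ⊥) {x y : L} (hx : x ∈ rootSpace H α) (hx₀ : x ≠ 0)
    (hy : y ∈ rootSpace H β) (hy₀ : y ≠ 0) : ⁅x, y⁆ ≠ 0 := by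
  intro hxy
  obtain ⟨z, hz, hz₀⟩ := (chainTop (-α) β).exists_ne_zero
  obtain ⟨_, e, f, isSl2, he, hf⟩ := exists_isSl2Triple_of_weight_isNonZero hα.neg
  obtain rfl := isSl2.h_eq_coroot hα.neg he hf
  have hez := lie_mem_genWeightSpace_of_mem_genWeightSpace he hz
  rw [genWeightSpace_add_chainTop _ _ hα.neg] at hez
  have prim : isSl2.HasPrimitiveVectorWith z (chainLength (-α) β : K) :=
    ⟨hz₀, (chainLength_smul _ _ hz).symm, hez⟩
  -- `f` spans the root space of `α` and lowers `z` to a nonzero vector beyond that of `β`.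
  apply prim.pow_toEnd_f_ne_zero_of_eq_nat rfl (chainTopCoeff_neg_lt_chainLength hα h)
  have hmem := toEnd_pow_apply_mem hf hz (chainTopCoeff (-α) β)
  have hweight : (chainTopCoeff (-α) β • -((-α : Weight K H L) : H → K) + chainTop (-α) β : H → K)
      = β := by
    rw [coe_chainTop', smul_neg, neg_add_cancel_left]
  rw [hweight] at hmem
  rw [Weight.coe_neg, neg_neg] at hf
  obtain ⟨c, hc⟩ := exists_eq_smul_of_mem_rootSpace hβ hy hy₀ hmem
  obtain ⟨d, rfl⟩ := exists_eq_smul_of_mem_rootSpace hα hx hx₀ hf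
  rw [pow_succ', Module.End.mul_apply, hc, toEnd_apply_apply, lie_smul, smul_lie, hxy, smul_zero,
    smul_zero]

end RootSpaces

section RootVectors

open Module LieModule LieAlgebra LieAlgebra.IsKilling

variable {L : Type*} [LieRing L] [LieAlgebra ℂ L] [FiniteDimensional ℂ L] [LieAlgebra.IsKilling ℂ L]
  {H : LieSubalgebra ℂ L} [H.IsCartanSubalgebra]

/-- The negative of a root, so that `E_{-α}` is `E.vec (-α).1`. -/
noncomputable instance : InvolutiveNeg H.root where
  neg α := ⟨-α.1, by simpa using H.isNonZero_coe_root α⟩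
  neg_neg α := Subtype.ext (neg_neg α.1)

theorem root_neg (α : H.root) : (rootSystem H).root (-α) = -(rootSystem H).root α := rfl

theorem reflectionPerm_self (α : H.root) : (rootSystem H).reflectionPerm α α = -α := by
  apply (rootSystem H).root.injective
  rw [root_neg, (rootSystem H).root_reflectionPerm, (rootSystem H).reflection_apply_self]

theorem isPos_neg_iff (b : (rootSystem H).Base) (α : H.root) : b.IsPos (-α) ↔ ¬ b.IsPos α := by
  rw [← reflectionPerm_self]
  let := (rootSystem H).indexNeg
  exact RootPairing.Base.IsPos.neg_iff_not b α

theorem coe_eq_add_of_root_eq {α β γ : H.root}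
    (h : (rootSystem H).root γ = (rootSystem H).root α + (rootSystem H).root β) :
    (γ.1 : H → ℂ) = α.1 + β.1 :=
  funext (LinearMap.congr_fun h)

theorem eq_neg_of_coe_add_eq_zero {α β : H.root} (h : (α.1 + β.1 : H → ℂ) = 0) : β = -α :=
  Subtype.ext (DFunLike.coe_injective (eq_neg_of_add_eq_zero_right h))

namespace RootVectors

variable (E : RootVectors H)

theorem mem (α : H.root) : E.vec α.1 ∈ rootSpace H α.1 := E.mem_rootSpace α.1 α.2

theorem killing_neg (α : H.root) : killingForm ℂ L (E.vec α.1) (E.vec (-α.1)) = 1 :=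
  E.killing_eq_one α.1 α.2

theorem ne_zero (α : H.root) : E.vec α.1 ≠ 0 := by
  intro h
  simpa [h] using E.killing_neg α

open Classical in
theorem killing_vec (α β : H.root) :
    killingForm ℂ L (E.vec α.1) (E.vec β.1) = if β = -α then 1 else 0 := by
  split_ifs with h
  · subst h
    exact E.killing_neg α
  · exact killingForm_apply_eq_zero_of_mem_rootSpace_of_add_ne_zero ℂ L H (E.mem α) (E.mem β)
      fun h₀ => h (eq_neg_of_coe_add_eq_zero h₀)

theorem killing_cartan (α : H.root) {x : L} (hx : x ∈ H) :
    killingForm ℂ L (E.vec α.1) x = 0 := by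
  have hx₀ : x ∈ rootSpace H (0 : H → ℂ) := toLieSubmodule_le_rootSpace_zero ℂ L H hx
  apply killingForm_apply_eq_zero_of_mem_rootSpace_of_add_ne_zero ℂ L H (E.mem α) hx₀
  rw [add_zero]
  exact H.isNonZero_coe_root α

theorem lie_cartan (α : H.root) (h : H) : ⁅(h : L), E.vec α.1⁆ = α.1 h • E.vec α.1 :=
  lie_eq_smul_of_mem_rootSpace (E.mem α) h

theorem exists_eq_smul (α : H.root) {x : L} (hx : x ∈ rootSpace H α.1) :
    ∃ c : ℂ, x = c • E.vec α.1 :=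
  exists_eq_smul_of_mem_rootSpace (H.isNonZero_coe_root α) (E.mem α) (E.ne_zero α) hx

theorem lie_vec_neg (α : H.root) :
    ⁅E.vec α.1, E.vec (-α.1)⁆ = ((cartanEquivDual H).symm α.1 : L) := by
  have h : E.vec (-α.1) ∈ rootSpace H (-α.1 : H → ℂ) := E.mem (-α)
  rw [lie_eq_killingForm_smul_of_mem_rootSpace_of_mem_rootSpace_neg (E.mem α) h,
    E.killing_neg, one_smul]

theorem span_eq_top :
    H.toSubmodule ⊔ Submodule.span ℂ (Set.range fun α : H.root => E.vec α.1) = ⊤ := by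
  rw [eq_top_iff, ← LieSubmodule.top_toSubmodule (R := ℂ) (L := H),
    ← LieModule.iSup_genWeightSpace_eq_top' ℂ H L, LieSubmodule.iSup_toSubmodule, iSup_le_iff]
  intro χ x hx
  by_cases hχ : χ.IsZero
  · have hH : x ∈ H.toLieSubmodule := by
      rw [← rootSpace_zero_eq ℂ L H, ← hχ.eq]
      exact hx
    exact Submodule.mem_sup_left hH
  · obtain ⟨c, rfl⟩ := E.exists_eq_smul ⟨χ, by simpa using hχ⟩ hx
    exact Submodule.mem_sup_right (Submodule.smul_mem _ _ (Submodule.subset_span ⟨_, rfl⟩))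

theorem hom_ext {N : Type*} [AddCommGroup N] [Module ℂ N] {φ ψ : L →ₗ[ℂ] N}
    (hH : ∀ h ∈ H, φ h = ψ h) (hE : ∀ α : H.root, φ (E.vec α.1) = ψ (E.vec α.1)) : φ = ψ := by
  rw [← LinearMap.eqLocus_eq_top, eq_top_iff, ← E.span_eq_top, sup_le_iff, Submodule.span_le]
  exact ⟨hH, Set.range_subset_iff.2 hE⟩

theorem exists_lie_vec_eq_smul {α β γ : H.root}
    (h : (rootSystem H).root γ = (rootSystem H).root α + (rootSystem H).root β) :
    ∃ c : ℂ, c ≠ 0 ∧ ⁅E.vec α.1, E.vec β.1⁆ = c • E.vec γ.1 := by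
  have hγ := coe_eq_add_of_root_eq h
  have hne : ⁅E.vec α.1, E.vec β.1⁆ ≠ 0 :=
    lie_ne_zero_of_mem_rootSpace (H.isNonZero_coe_root α) (H.isNonZero_coe_root β)
      (hγ ▸ γ.1.genWeightSpace_ne_bot) (E.mem α) (E.ne_zero α) (E.mem β) (E.ne_zero β)
  obtain ⟨c, hc⟩ := E.exists_eq_smul γ
    (hγ ▸ lie_mem_genWeightSpace_of_mem_genWeightSpace (E.mem α) (E.mem β))
  exact ⟨c, fun h₀ => hne (by rw [hc, h₀, zero_smul]), hc⟩

theorem lie_vec_eq_zero {α β : H.root} (hβ : β ≠ -α)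
    (h : ∀ γ : H.root, (rootSystem H).root γ ≠ (rootSystem H).root α + (rootSystem H).root β) :
    ⁅E.vec α.1, E.vec β.1⁆ = 0 := by
  have hmem := lie_mem_genWeightSpace_of_mem_genWeightSpace (E.mem α) (E.mem β)
  by_contra hne
  let γ : Weight ℂ H L :=
    ⟨α.1 + β.1, fun hbot => hne ((LieSubmodule.mem_bot (R := ℂ) (L := H) _).1 (hbot ▸ hmem))⟩
  have hγ : γ.IsNonZero := fun hzero => hβ (eq_neg_of_coe_add_eq_zero hzero)
  exact h ⟨γ, by simpa using hγ⟩ (LinearMap.ext fun _ => rfl)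

theorem killing_lie_ne_zero_iff {α β γ : H.root} :
    killingForm ℂ L ⁅E.vec α.1, E.vec β.1⁆ (E.vec γ.1) ≠ 0 ↔
      (rootSystem H).root α + (rootSystem H).root β + (rootSystem H).root γ = 0 := by
  constructor
  · intro h
    by_contra h₀
    exact h (killingForm_apply_eq_zero_of_mem_rootSpace_of_add_ne_zero ℂ L H
      (lie_mem_genWeightSpace_of_mem_genWeightSpace (E.mem α) (E.mem β)) (E.mem γ)
      fun hsum => h₀ (LinearMap.ext (congrFun hsum)))
  · intro h
    obtain ⟨c, hc, hαβ⟩ := E.exists_lie_vec_eq_smul (α := α) (β := β) (γ := -γ)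
      (eq_neg_of_add_eq_zero_left h).symm
    rw [hαβ, map_smul, LinearMap.smul_apply, E.killing_vec, if_pos (neg_neg γ).symm]
    simpa using hc

end RootVectors

end RootVectors

section Levi

open Module LieModule LieAlgebra LieAlgebra.IsKilling
open scoped ExteriorAlgebra

variable {L : Type*} [LieRing L] [LieAlgebra ℂ L] [FiniteDimensional ℂ L] [LieAlgebra.IsKilling ℂ L]
  {H : LieSubalgebra ℂ L} [H.IsCartanSubalgebra] {E : RootVectors H} {Γ : Finset H.root}

theorem RootVectors.dual_eq_sum (E : RootVectors H) {d : Dual ℂ L} (hd : ∀ x ∈ H, d x = 0) :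
    d = ∑ α : H.root, d (E.vec (-α.1)) • killingForm ℂ L (E.vec α.1) := by
  refine E.hom_ext (fun x hx => ?_) fun β => ?_
  · simp [hd x hx, E.killing_cartan _ hx]
  · rw [LinearMap.sum_apply, Finset.sum_eq_single (-β)]
    · change d _ = d (E.vec (-(-β : H.root)).1) • _
      rw [neg_neg, E.killing_vec, if_pos (neg_neg β).symm, smul_eq_mul, mul_one]
    · intro α _ hα
      rw [LinearMap.smul_apply, E.killing_vec, if_neg fun h => hα (by rw [h, neg_neg]), smul_zero]
    · exact fun h => absurd (Finset.mem_univ _) h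

theorem mem_leviRoots {α : H.root} (hα : α ∈ Γ) : α ∈ leviRoots Γ :=
  Submodule.subset_span ⟨α, hα, rfl⟩

theorem neg_mem_leviRoots_iff {α : H.root} : -α ∈ leviRoots Γ ↔ α ∈ leviRoots Γ :=
  (rootSpan Γ).neg_mem_iff (x := (rootSystem H).root α)

theorem mem_levi_of_mem_cartan {x : L} (hx : x ∈ H) : x ∈ levi E Γ :=
  LieSubalgebra.subset_lieSpan (Or.inl hx)

theorem levi_le {A : LieSubalgebra ℂ L} (hH : H ≤ A) (hE : ∀ α ∈ leviRoots Γ, E.vec α.1 ∈ A) :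
    levi E Γ ≤ A := by
  refine LieSubalgebra.lieSpan_le.2 ?_
  rintro x (hx | ⟨α, hα, rfl | rfl⟩)
  · exact hH hx
  · exact hE α (mem_leviRoots hα)
  · exact hE (-α) (neg_mem_leviRoots_iff.2 (mem_leviRoots hα))

theorem exists_cartan_separating {γ : H.root} (hγ : γ ∉ leviRoots Γ) :
    ∃ h : H, (∀ α ∈ leviRoots Γ, α.1 h = 0) ∧ γ.1 h ≠ 0 := by
  have hγ_span : (rootSystem H).root γ ∉ rootSpan Γ := hγ
  obtain ⟨φ, hφ, hker⟩ := Submodule.exists_le_ker_of_notMem hγ_span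
  have hφ_apply (α : H.root) : α.1 ((evalEquiv ℂ H).symm φ) = φ ((rootSystem H).root α) :=
    apply_evalEquiv_symm_apply ℂ H ((rootSystem H).root α) φ
  exact ⟨(evalEquiv ℂ H).symm φ, fun α hα => (hφ_apply α).trans (hker hα), by rwa [hφ_apply]⟩

theorem killing_levi_vec {x : L} (hx : x ∈ levi E Γ) {γ : H.root} (hγ : γ ∉ leviRoots Γ) :
    killingForm ℂ L x (E.vec γ.1) = 0 := by
  -- A Cartan element killed by `Γ` but not by `γ` is central in the Levi subalgebra.
  obtain ⟨h, h_levi, h_ne⟩ := exists_cartan_separating hγ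
  have hle : levi E Γ ≤ coadjointStabilizer (killingForm ℂ L h) := by
    refine levi_le (fun x hx y => ?_) fun α hα y => ?_
    · have hcomm : ⁅(h : L), x⁆ = 0 := congrArg Subtype.val (trivial_lie_zero H H h ⟨x, hx⟩)
      rw [← killingForm_lie, hcomm, map_zero, LinearMap.zero_apply]
    · rw [← killingForm_lie, E.lie_cartan, h_levi α hα, zero_smul, map_zero, LinearMap.zero_apply]
  have hzero : killingForm ℂ L (h : L) ⁅x, E.vec γ.1⁆ = 0 := hle hx _
  rw [← killingForm_lie, ← lie_skew, map_neg, LinearMap.neg_apply, killingForm_lie, E.lie_cartan,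
    map_smul, smul_eq_mul, neg_eq_zero, mul_eq_zero] at hzero
  exact hzero.resolve_left h_ne

/-- The functional on `h*` induced by a functional `lam` on `L` through the identification of `h`
with `h*` by the Killing form; its value at a root `α` is `lam [E_α, E_{-α}]`. -/
noncomputable def dualFunctional (H : LieSubalgebra ℂ L) [H.IsCartanSubalgebra] (lam : Dual ℂ L) :
    Dual ℂ (Dual ℂ H) :=
  lam ∘ₗ H.toSubmodule.subtype ∘ₗ (cartanEquivDual H).symm.toLinearMap

theorem dualFunctional_root (E : RootVectors H) (lam : Dual ℂ L) (α : H.root) :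
    dualFunctional H lam ((rootSystem H).root α) = lam ⁅E.vec α.1, E.vec (-α.1)⁆ := by
  rw [E.lie_vec_neg]
  rfl

section Stabilizer

variable {lam : Dual ℂ L} (hlam : coadjointStabilizer lam = levi E Γ)
include hlam

theorem apply_eq_zero_of_mem_rootSpace {δ : H → ℂ} (hδ : δ ≠ 0) {x : L} (hx : x ∈ rootSpace H δ) :
    lam x = 0 := by
  obtain ⟨h, hh⟩ := Function.ne_iff.1 hδ
  have h_stab : (h : L) ∈ coadjointStabilizer lam := hlam ▸ mem_levi_of_mem_cartan h.2
  have hzero : lam ⁅(h : L), x⁆ = 0 := h_stab x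
  have hweight : ⁅(h : L), x⁆ = δ h • x := lie_eq_smul_of_mem_rootSpace hx h
  rw [hweight, map_smul, smul_eq_mul, mul_eq_zero] at hzero
  exact hzero.resolve_left hh

theorem vec_mem_levi_of_dualFunctional_eq_zero {α : H.root}
    (hα : dualFunctional H lam ((rootSystem H).root α) = 0) : E.vec α.1 ∈ levi E Γ := by
  rw [← hlam]
  suffices lam ∘ₗ (ad ℂ L (E.vec α.1) : L →ₗ[ℂ] L) = 0 from LinearMap.congr_fun this
  refine E.hom_ext (fun h hh => ?_) fun β => ?_
  · have hweight : ⁅h, E.vec α.1⁆ = α.1 ⟨h, hh⟩ • E.vec α.1 := E.lie_cartan α ⟨h, hh⟩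
    rw [LinearMap.comp_apply, ad_apply, ← lie_skew, hweight, map_neg, map_smul,
      apply_eq_zero_of_mem_rootSpace hlam (H.isNonZero_coe_root α) (E.mem α), smul_zero, neg_zero,
      LinearMap.zero_apply]
  · rw [LinearMap.comp_apply, ad_apply, LinearMap.zero_apply]
    by_cases hβ : β = -α
    · rw [hβ, ← hα, dualFunctional_root E]
      rfl
    · exact apply_eq_zero_of_mem_rootSpace hlam (fun h => hβ (eq_neg_of_coe_add_eq_zero h))
        (lie_mem_genWeightSpace_of_mem_genWeightSpace (E.mem α) (E.mem β))

theorem rootSpan_le_ker_dualFunctional : rootSpan Γ ≤ LinearMap.ker (dualFunctional H lam) := by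
  refine Submodule.span_le.2 ?_
  rintro _ ⟨α, hα, rfl⟩
  have h_stab : E.vec α.1 ∈ coadjointStabilizer lam :=
    hlam ▸ LieSubalgebra.subset_lieSpan (Or.inr ⟨α, hα, Or.inl rfl⟩)
  exact (dualFunctional_root E lam α).trans (h_stab _)

theorem dualFunctional_root_eq_zero_iff (α : H.root) :
    dualFunctional H lam ((rootSystem H).root α) = 0 ↔ α ∈ leviRoots Γ := by
  refine ⟨fun h => ?_, fun h => rootSpan_le_ker_dualFunctional hlam h⟩
  by_contra hα
  have horth : killingForm ℂ L (E.vec α.1) (E.vec (-α.1)) = 0 :=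
    killing_levi_vec (vec_mem_levi_of_dualFunctional_eq_zero hlam h)
      (mt neg_mem_leviRoots_iff.1 hα)
  exact one_ne_zero ((E.killing_neg α).symm.trans horth)

theorem vec_mem_levi {α : H.root} (hα : α ∈ leviRoots Γ) : E.vec α.1 ∈ levi E Γ :=
  vec_mem_levi_of_dualFunctional_eq_zero hlam ((dualFunctional_root_eq_zero_iff hlam α).2 hα)

theorem mem_span_killing_of_forall_mem_levi {d : Dual ℂ L} (hd : ∀ x ∈ levi E Γ, d x = 0) :
    d ∈ Submodule.span ℂ ((fun γ : H.root => killingForm ℂ L (E.vec γ.1)) '' (leviRoots Γ)ᶜ) := by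
  rw [E.dual_eq_sum fun x hx => hd x (mem_levi_of_mem_cartan hx)]
  refine Submodule.sum_mem _ fun γ _ => ?_
  by_cases hγ : γ ∈ leviRoots Γ
  · have hzero : d (E.vec (-γ.1)) = 0 := hd _ (vec_mem_levi hlam (neg_mem_leviRoots_iff.2 hγ))
    rw [hzero, zero_smul]
    exact Submodule.zero_mem _
  · exact Submodule.smul_mem _ _ (Submodule.subset_span ⟨γ, hγ, rfl⟩)

theorem toM_eq_zero_iff {n : ℕ} {w : ExteriorAlgebra ℂ L} (hw : w ∈ ⋀[ℂ]^n L) :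
    toM E Γ w = 0 ↔ ∀ γ : Fin n → H.root, (∀ i, γ i ∉ leviRoots Γ) →
      evalCovectors (fun i => killingForm ℂ L (E.vec (γ i).1)) w = 0 := by
  constructor
  · intro h γ hγ
    let d (i : Fin n) : Dual ℂ (L ⧸ (levi E Γ).toSubmodule) :=
      (levi E Γ).toSubmodule.liftQ (killingForm ℂ L (E.vec (γ i).1)) fun x hx => by
        rw [LinearMap.mem_ker, killingForm_comm]
        exact killing_levi_vec hx (hγ i)
    have hzero : evalCovectors d (toM E Γ w) = 0 := by rw [h, map_zero]
    rwa [toM, evalCovectors_map _ _ hw] at hzero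
  · refine fun h => eq_zero_of_forall_evalCovectors (map_mem_exteriorPower _ hw) fun d => ?_
    rw [toM, evalCovectors_map _ _ hw]
    refine evalCovectors_eq_zero_of_mem_span hw (fun d hd => ?_) fun i =>
      mem_span_killing_of_forall_mem_levi hlam fun x hx => ?_
    · choose γ hγ hd using hd
      rw [← funext hd]
      exact h γ hγ
    · rw [LinearMap.comp_apply, Submodule.mkQ_apply, (Submodule.Quotient.mk_eq_zero _).2 hx,
        map_zero]

end Stabilizer

end Levi

section SchoutenBrackets

open Module LieModule LieAlgebra LieAlgebra.IsKilling
open scoped ExteriorAlgebra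

variable {L : Type*} [LieRing L] [LieAlgebra ℂ L] [FiniteDimensional ℂ L] [LieAlgebra.IsKilling ℂ L]
  {H : LieSubalgebra ℂ L} [H.IsCartanSubalgebra] {E : RootVectors H} {Γ : Finset H.root}

theorem evalCovectors_schouten_vec {f g : ⋀[ℂ]^2 L} {s t : H.root → ℂ}
    (hf : ∀ α : H.root, toEndo f (E.vec α.1) = s α • E.vec α.1)
    (hg : ∀ α : H.root, toEndo g (E.vec α.1) = t α • E.vec α.1) (α β γ : H.root) :
    evalCovectors ![killingForm ℂ L (E.vec α.1), killingForm ℂ L (E.vec β.1),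
        killingForm ℂ L (E.vec γ.1)] (schouten f g) =
      (s α * t β + t α * s β + s β * t γ + t β * s γ + s γ * t α + t γ * s α) *
        killingForm ℂ L ⁅E.vec α.1, E.vec β.1⁆ (E.vec γ.1) := by
  have hcyclic : ∀ x y z : L, killingForm ℂ L ⁅y, z⁆ x = killingForm ℂ L ⁅x, y⁆ z := fun x y z => by
    rw [killingForm_comm, ← killingForm_lie]
  rw [evalCovectors_schouten]
  simp only [hf, hg, smul_lie, lie_smul, map_add, map_smul, LinearMap.add_apply,
    LinearMap.smul_apply, smul_eq_mul, hcyclic (E.vec α.1) (E.vec β.1) (E.vec γ.1),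
    ← hcyclic (E.vec γ.1) (E.vec α.1) (E.vec β.1)]
  ring

theorem toM_eq_zero_iff_of_evalCovectors {lam : Dual ℂ L}
    (hlam : coadjointStabilizer lam = levi E Γ) {w : ExteriorAlgebra ℂ L} (hw : w ∈ ⋀[ℂ]^3 L)
    {q : H.root → H.root → H.root → ℂ}
    (hq : ∀ α β γ : H.root, evalCovectors ![killingForm ℂ L (E.vec α.1),
      killingForm ℂ L (E.vec β.1), killingForm ℂ L (E.vec γ.1)] w =
        q α β γ * killingForm ℂ L ⁅E.vec α.1, E.vec β.1⁆ (E.vec γ.1)) :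
    toM E Γ w = 0 ↔ ∀ α β γ : H.root, α ∉ leviRoots Γ → β ∉ leviRoots Γ → γ ∉ leviRoots Γ →
      (rootSystem H).root α + (rootSystem H).root β + (rootSystem H).root γ = 0 →
        q α β γ = 0 := by
  have heval (v : Fin 3 → H.root) : evalCovectors (fun i => killingForm ℂ L (E.vec (v i).1)) w =
      q (v 0) (v 1) (v 2) *
        killingForm ℂ L ⁅E.vec (v 0).1, E.vec (v 1).1⁆ (E.vec (v 2).1) := by
    rw [← hq, ← FinVec.etaExpand_eq fun i => killingForm ℂ L (E.vec (v i).1)]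
    rfl
  simp only [toM_eq_zero_iff hlam hw, heval, mul_eq_zero, ← E.killing_lie_ne_zero_iff]
  refine ⟨fun h α β γ hα hβ hγ hN => (h ![α, β, γ] fun i => ?_).resolve_right hN, fun h v hv =>
    or_iff_not_imp_right.2 (h _ _ _ (hv 0) (hv 1) (hv 2))⟩
  fin_cases i
  exacts [hα, hβ, hγ]

variable (b : (rootSystem H).Base)

open Classical in
/-- The bivector `∑ g α • E_α ∧ E_{-α}`, summed over the positive roots; every bivector on `m`
invariant under the Cartan subalgebra has this form. -/
noncomputable def rootBivector (E : RootVectors H) (g : H.root → ℂ) : ⋀[ℂ]^2 L :=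
  ∑ α : H.root with b.IsPos α, g α • wedge (E.vec α.1) (E.vec (-α.1))

open Classical in
theorem sum_isPos_add_neg {A : Type*} [AddCommMonoid A] (F : H.root → A) :
    ∑ α : H.root with b.IsPos α, (F α + F (-α)) = ∑ α : H.root, F α := by
  rw [Finset.sum_add_distrib, ← Finset.sum_filter_add_sum_filter_not Finset.univ b.IsPos F]
  congr 1
  exact Finset.sum_equiv (Equiv.neg H.root) (fun α => by simp [isPos_neg_iff]) fun _ _ => rfl

theorem toEndo_rootBivector_cartan (g : H.root → ℂ) {h : L} (hh : h ∈ H) :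
    toEndo (rootBivector b E g) h = 0 := by
  classical
  rw [rootBivector, map_sum, LinearMap.sum_apply]
  refine Finset.sum_eq_zero fun α _ => ?_
  have hneg : killingForm ℂ L (E.vec (-α.1)) h = 0 := E.killing_cartan (-α) hh
  rw [map_smul, LinearMap.smul_apply, toEndo_wedge, E.killing_cartan α hh, hneg, zero_smul,
    zero_smul, sub_zero, smul_zero]

theorem toEndo_rootBivector_vec {g : H.root → ℂ} (hg : ∀ α, g (-α) = -g α) (β : H.root) :
    toEndo (rootBivector b E g) (E.vec β.1) = -g β • E.vec β.1 := by
  classical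
  let F (α : H.root) : L := (g α * killingForm ℂ L (E.vec α.1) (E.vec β.1)) • E.vec (-α).1
  have hF (α : H.root) :
      toEndo (g α • wedge (E.vec α.1) (E.vec (-α.1))) (E.vec β.1) = F α + F (-α) := by
    simp only [F, hg, neg_neg, neg_smul, map_smul, LinearMap.smul_apply, toEndo_wedge,
      smul_sub, mul_smul, ← sub_eq_add_neg]
    rfl
  simp only [rootBivector, map_sum, LinearMap.sum_apply, hF]
  rw [sum_isPos_add_neg, Finset.sum_eq_single (-β)]
  · simp only [F, hg, neg_neg, E.killing_vec, if_true, mul_one]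
  · intro α _ hα
    have hβ : β ≠ -α := fun h => hα (by rw [h, neg_neg])
    simp only [F, E.killing_vec, if_neg hβ, mul_zero, zero_smul]
  · exact fun h => absurd (Finset.mem_univ _) h

open Classical in
/-- The sign of a root, `1` on the positive and `-1` on the negative roots. -/
noncomputable def rootSign (α : H.root) : ℂ := if b.IsPos α then 1 else -1

theorem rootSign_neg (α : H.root) : rootSign b (-α) = -rootSign b α := by
  by_cases h : b.IsPos α <;> simp [rootSign, isPos_neg_iff, h]

theorem rMatrix_eq : rMatrix b E = rootBivector b E (rootSign b) := by
  classical
  refine Finset.sum_congr rfl fun α hα => ?_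
  rw [rootSign, if_pos (Finset.mem_filter.1 hα).2, one_smul]

theorem not_isPos_of_add_eq_zero {α β γ : H.root}
    (h : (rootSystem H).root α + (rootSystem H).root β + (rootSystem H).root γ = 0)
    (hα : b.IsPos α) (hβ : b.IsPos β) : ¬ b.IsPos γ := by
  rw [← isPos_neg_iff]
  exact hα.add hβ (by rw [root_neg, eq_neg_of_add_eq_zero_left h])

theorem rootSign_mul_sum {α β γ : H.root}
    (h : (rootSystem H).root α + (rootSystem H).root β + (rootSystem H).root γ = 0) :
    rootSign b α * rootSign b β + rootSign b β * rootSign b γ + rootSign b γ * rootSign b α =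
      -1 := by
  have hpos := not_isPos_of_add_eq_zero b h
  have hneg := not_isPos_of_add_eq_zero b (α := -α) (β := -β) (γ := -γ) (by
    simp only [root_neg, ← neg_add, h, neg_zero])
  simp only [isPos_neg_iff, not_not] at hneg
  by_cases hα : b.IsPos α <;> by_cases hβ : b.IsPos β <;> by_cases hγ : b.IsPos γ <;>
    simp_all [rootSign]

section Stabilizer

variable {lam : Dual ℂ L} (hlam : coadjointStabilizer lam = levi E Γ)
include hlam

theorem kks_eq :
    kks b E Γ lam =
      rootBivector b E fun α => (dualFunctional H lam ((rootSystem H).root α))⁻¹ := by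
  classical
  rw [kks, rootBivector, ← Finset.filter_filter, Finset.sum_filter]
  refine Finset.sum_congr rfl fun α _ => ?_
  by_cases h : α ∈ leviRoots Γ
  · rw [if_neg (not_not.2 h), (dualFunctional_root_eq_zero_iff hlam α).2 h, inv_zero, zero_smul]
  · rw [if_pos h, dualFunctional_root E]

theorem toM_schouten_self_iff {f : ⋀[ℂ]^2 L} {s : H.root → ℂ}
    (hf : ∀ α : H.root, toEndo f (E.vec α.1) = s α • E.vec α.1) (c : ℂ) :
    toM E Γ (schouten f f) = c ^ 2 • toM E Γ (phi b E) ↔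
      ∀ α β γ : H.root, α ∉ leviRoots Γ → β ∉ leviRoots Γ → γ ∉ leviRoots Γ →
        (rootSystem H).root α + (rootSystem H).root β + (rootSystem H).root γ = 0 →
          s α * s β + s β * s γ + s γ * s α = -c ^ 2 := by
  have hmem : schouten f f - c ^ 2 • phi b E ∈ ⋀[ℂ]^3 L :=
    Submodule.sub_mem _ (schouten_mem _ _) (Submodule.smul_mem _ _ (schouten_mem _ _))
  have hr := toEndo_rootBivector_vec (E := E) b (rootSign_neg b)
  have heval (α β γ : H.root) := show evalCovectors ![killingForm ℂ L (E.vec α.1),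
      killingForm ℂ L (E.vec β.1), killingForm ℂ L (E.vec γ.1)]
        (schouten f f - c ^ 2 • phi b E) =
      2 * (s α * s β + s β * s γ + s γ * s α - c ^ 2 * (rootSign b α * rootSign b β +
        rootSign b β * rootSign b γ + rootSign b γ * rootSign b α)) *
          killingForm ℂ L ⁅E.vec α.1, E.vec β.1⁆ (E.vec γ.1) by
    rw [phi, rMatrix_eq, map_sub, map_smul, evalCovectors_schouten_vec hf hf,
      evalCovectors_schouten_vec hr hr, smul_eq_mul]
    ring
  rw [← sub_eq_zero, ← map_smul, ← map_sub, toM_eq_zero_iff_of_evalCovectors hlam hmem heval]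
  refine forall₃_congr fun α β γ => forall₄_congr fun _ _ _ h => ?_
  rw [rootSign_mul_sum b h, mul_eq_zero, or_iff_right two_ne_zero, sub_eq_zero, mul_neg_one]

theorem toM_schouten_kks_iff {f : ⋀[ℂ]^2 L} {s : H.root → ℂ}
    (hf : ∀ α : H.root, toEndo f (E.vec α.1) = s α • E.vec α.1) :
    toM E Γ (schouten f (kks b E Γ lam)) = 0 ↔
      ∀ α β γ : H.root, α ∉ leviRoots Γ → β ∉ leviRoots Γ → γ ∉ leviRoots Γ →
        (rootSystem H).root α + (rootSystem H).root β + (rootSystem H).root γ = 0 →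
          dualFunctional H lam ((rootSystem H).root α) ^ 2 * s α +
            dualFunctional H lam ((rootSystem H).root β) ^ 2 * s β +
            dualFunctional H lam ((rootSystem H).root γ) ^ 2 * s γ = 0 := by
  have hv := toEndo_rootBivector_vec (E := E) b
    (g := fun α => (dualFunctional H lam ((rootSystem H).root α))⁻¹)
    fun α => by rw [root_neg, map_neg, inv_neg]
  rw [kks_eq b hlam, toM_eq_zero_iff_of_evalCovectors hlam (schouten_mem _ _)
    (evalCovectors_schouten_vec hf hv)]
  refine forall₃_congr fun α β γ => forall₄_congr fun hα hβ hγ h => ?_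
  have hne (δ : H.root) (hδ : δ ∉ leviRoots Γ) : dualFunctional H lam ((rootSystem H).root δ) ≠ 0 :=
    mt (dualFunctional_root_eq_zero_iff hlam δ).1 hδ
  have hsum := congrArg (dualFunctional H lam) h
  rw [map_add, map_add, map_zero] at hsum
  have hx := hne α hα
  have hy := hne β hβ
  have hz := hne γ hγ
  set x := dualFunctional H lam ((rootSystem H).root α)
  set y := dualFunctional H lam ((rootSystem H).root β)
  set z := dualFunctional H lam ((rootSystem H).root γ)
  have hfrac : s α * -y⁻¹ + -x⁻¹ * s β + s β * -z⁻¹ + -y⁻¹ * s γ + s γ * -x⁻¹ + -z⁻¹ * s α =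
      (x ^ 2 * s α + y ^ 2 * s β + z ^ 2 * s γ) / (x * y * z) := by
    field_simp
    linear_combination -(s α * x + s β * y + s γ * z) * hsum
  rw [hfrac, div_eq_zero_iff, or_iff_left (mul_ne_zero (mul_ne_zero hx hy) hz)]

end Stabilizer

end SchoutenBrackets

section GoodOrbits

open Module LieModule LieAlgebra LieAlgebra.IsKilling
open scoped ExteriorAlgebra

variable {L : Type*} [LieRing L] [LieAlgebra ℂ L] [FiniteDimensional ℂ L] [LieAlgebra.IsKilling ℂ L]
  {H : LieSubalgebra ℂ L} [H.IsCartanSubalgebra]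

/-- The conditions on the eigenvalues `s α` with which `toEndo f` acts on the root vectors `E_α`
under which a bivector `f` shows the orbit of a functional `lam` to be good with `K = 1`. Here `l`
stands for `dualFunctional H lam`, which vanishes exactly on the roots of the Levi subalgebra. -/
structure IsGoodEigenvalues (l : Dual ℂ (Dual ℂ H)) (s : H.root → ℂ) : Prop where
  neg (α : H.root) : s (-α) = -s α
  eq_of_add {α β γ : H.root} (hα : l ((rootSystem H).root α) = 0)
    (h : (rootSystem H).root γ = (rootSystem H).root α + (rootSystem H).root β) : s γ = s β
  mul_sum {α β γ : H.root} (hα : l ((rootSystem H).root α) ≠ 0)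
    (hβ : l ((rootSystem H).root β) ≠ 0) (hγ : l ((rootSystem H).root γ) ≠ 0)
    (h : (rootSystem H).root α + (rootSystem H).root β + (rootSystem H).root γ = 0) :
    s α * s β + s β * s γ + s γ * s α = -1
  sq_mul_sum_of_ne_zero {α β γ : H.root} (hα : l ((rootSystem H).root α) ≠ 0)
    (hβ : l ((rootSystem H).root β) ≠ 0) (hγ : l ((rootSystem H).root γ) ≠ 0)
    (h : (rootSystem H).root α + (rootSystem H).root β + (rootSystem H).root γ = 0) :
    l ((rootSystem H).root α) ^ 2 * s α + l ((rootSystem H).root β) ^ 2 * s β +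
      l ((rootSystem H).root γ) ^ 2 * s γ = 0

namespace IsGoodEigenvalues

variable {l m : Dual ℂ (Dual ℂ H)} {s : H.root → ℂ}

theorem sq_mul_sum_of_eq_zero (hs : IsGoodEigenvalues l s) {α β γ : H.root}
    (hα : l ((rootSystem H).root α) = 0)
    (h : (rootSystem H).root α + (rootSystem H).root β + (rootSystem H).root γ = 0) :
    l ((rootSystem H).root α) ^ 2 * s α + l ((rootSystem H).root β) ^ 2 * s β +
      l ((rootSystem H).root γ) ^ 2 * s γ = 0 := by
  have hs_eq : s (-γ) = s β := hs.eq_of_add hα (by rw [root_neg, eq_neg_of_add_eq_zero_left h])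
  have hl := congrArg l h
  rw [map_add, map_add, map_zero, hα, zero_add] at hl
  rw [hα, eq_neg_of_add_eq_zero_left hl, ← hs_eq, hs.neg]
  ring

theorem sq_mul_sum (hs : IsGoodEigenvalues l s) {α β γ : H.root}
    (h : (rootSystem H).root α + (rootSystem H).root β + (rootSystem H).root γ = 0) :
    l ((rootSystem H).root α) ^ 2 * s α + l ((rootSystem H).root β) ^ 2 * s β +
      l ((rootSystem H).root γ) ^ 2 * s γ = 0 := by
  by_cases hα : l ((rootSystem H).root α) = 0
  · exact hs.sq_mul_sum_of_eq_zero hα h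
  by_cases hβ : l ((rootSystem H).root β) = 0
  · have hcyclic : (rootSystem H).root β + (rootSystem H).root γ + (rootSystem H).root α = 0 := by
      rw [← h]
      abel
    linear_combination hs.sq_mul_sum_of_eq_zero hβ hcyclic
  by_cases hγ : l ((rootSystem H).root γ) = 0
  · have hcyclic : (rootSystem H).root γ + (rootSystem H).root α + (rootSystem H).root β = 0 := by
      rw [← h]
      abel
    linear_combination hs.sq_mul_sum_of_eq_zero hγ hcyclic
  exact hs.sq_mul_sum_of_ne_zero hα hβ hγ h

theorem exists_dual (hs : IsGoodEigenvalues l s) (b : (rootSystem H).Base) :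
    ∃ m : Dual ℂ (Dual ℂ H), ∀ α : H.root,
      m ((rootSystem H).root α) = l ((rootSystem H).root α) ^ 2 * s α := by
  refine exists_dual_of_additive b _ (fun α => ?_) fun α β γ h => ?_
  · rw [reflectionPerm_self, hs.neg, root_neg, map_neg]
    ring
  · have hsum := hs.sq_mul_sum (α := α) (β := β) (γ := -γ) (by rw [root_neg, h, add_neg_cancel])
    rw [hs.neg, root_neg, map_neg] at hsum
    linear_combination -hsum

theorem exists_isQuadraticPair (hs : IsGoodEigenvalues l s) (b : (rootSystem H).Base) :
    ∃ m, IsQuadraticPair (rootSystem H) l m := by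
  obtain ⟨m, hm⟩ := hs.exists_dual b
  refine ⟨m, fun α hα => by rw [hm, hα]; ring, fun α β γ h => ?_⟩
  have hl := congrArg l h
  have hlm := congrArg m h
  rw [map_add] at hl hlm
  rw [hm, hm, hm] at hlm
  rw [hm, hm]
  by_cases hα : l ((rootSystem H).root α) = 0
  · rw [hα]
    ring
  by_cases hβ : l ((rootSystem H).root β) = 0
  · rw [hβ]
    ring
  by_cases hγ : l ((rootSystem H).root γ) = 0
  · rw [hγ] at hl hlm ⊢
    rw [eq_neg_of_add_eq_zero_right hl.symm] at hlm ⊢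
    linear_combination -(l ((rootSystem H).root α) ^ 4 * (s α + s β)) * hlm
  · have hmul := hs.mul_sum (γ := -γ) hα hβ (by rwa [root_neg, map_neg, neg_ne_zero])
      (by rw [root_neg, h, add_neg_cancel])
    rw [hs.neg] at hmul
    set x := l ((rootSystem H).root α)
    set y := l ((rootSystem H).root β)
    rw [hl] at hlm ⊢
    linear_combination (-x ^ 2 * y ^ 2 * (x + y) ^ 2) * hmul - x ^ 2 * y ^ 2 * (s α + s β) * hlm

theorem of_isQuadraticPair (h : IsQuadraticPair (rootSystem H) l m) :
    IsGoodEigenvalues l fun α => m ((rootSystem H).root α) / l ((rootSystem H).root α) ^ 2 where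
  neg α := by rw [root_neg, map_neg, map_neg, neg_sq, neg_div]
  eq_of_add hα hsum := by simp only [hsum, map_add, hα, h.1 _ hα, zero_add]
  mul_sum {α β γ} hα hβ hγ hsum := by
    have hroot := eq_neg_of_add_eq_zero_right hsum
    have hquad := h.2 α β (-γ) (by rw [root_neg, hroot, neg_neg])
    rw [root_neg] at hquad
    rw [hroot, map_neg, map_add] at hγ ⊢
    rw [hroot, neg_neg, map_add] at hquad
    rw [map_neg, map_add]
    have hne := neg_ne_zero.1 hγ
    field_simp
    linear_combination -hquad
  sq_mul_sum_of_ne_zero hα hβ hγ hsum := by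
    have hm := congrArg m hsum
    rw [map_add, map_add, map_zero] at hm
    rw [← hm]
    field_simp

end IsGoodEigenvalues

section Eigenvalues

variable {E : RootVectors H} {f : ⋀[ℂ]^2 L} {s : H.root → ℂ}

theorem exists_toEndo_vec_eq_smul (hf : ∀ x ∈ H, adBivector x f = 0) :
    ∃ s : H.root → ℂ, ∀ α : H.root, toEndo f (E.vec α.1) = s α • E.vec α.1 := by
  suffices ∀ α : H.root, toEndo f (E.vec α.1) ∈ rootSpace H α.1 from
    Classical.skolem.1 fun α => E.exists_eq_smul α (this α)
  refine fun α => (mem_genWeightSpace L α.1 _).2 fun x => ⟨1, ?_⟩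
  rw [pow_one, LinearMap.sub_apply, LinearMap.smul_apply, Module.End.one_apply, sub_eq_zero]
  calc ⁅(x : L), toEndo f (E.vec α.1)⁆ = toEndo f ⁅(x : L), E.vec α.1⁆ :=
        adBivector_eq_zero_iff.1 (hf x x.2) _
    _ = α.1 x • toEndo f (E.vec α.1) := by rw [E.lie_cartan, map_smul]

variable (hs : ∀ α : H.root, toEndo f (E.vec α.1) = s α • E.vec α.1)
include hs

theorem toEndo_eigenvalue_neg (α : H.root) : s (-α) = -s α := by
  have hskew := killingForm_toEndo f (E.vec α.1) (E.vec (-α : H.root).1)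
  rw [hs, hs, map_smul, map_smul, LinearMap.smul_apply, E.killing_vec, if_pos rfl, smul_eq_mul,
    smul_eq_mul, mul_one, mul_one] at hskew
  rw [hskew, neg_neg]

theorem toEndo_eigenvalue_eq_of_add {α β γ : H.root}
    (h : (rootSystem H).root γ = (rootSystem H).root α + (rootSystem H).root β)
    (hα : adBivector (E.vec α.1) f = 0) : s γ = s β := by
  obtain ⟨c, hc, hαβ⟩ := E.exists_lie_vec_eq_smul h
  have hcomm := adBivector_eq_zero_iff.1 hα (E.vec β.1)
  rw [hs, lie_smul, hαβ, map_smul, hs, smul_comm, smul_right_inj hc] at hcomm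
  exact (smul_left_injective ℂ (E.ne_zero γ) hcomm).symm

end Eigenvalues

/-- The Lie subalgebra of the elements whose adjoint action commutes with an endomorphism `T`. -/
def commutant (T : L →ₗ[ℂ] L) : LieSubalgebra ℂ L where
  carrier := {x | ∀ a, ⁅x, T a⁆ = T ⁅x, a⁆}
  add_mem' hx hy a := by rw [add_lie, add_lie, hx, hy, map_add]
  zero_mem' a := by rw [zero_lie, zero_lie, map_zero]
  smul_mem' c x hx a := by rw [smul_lie, smul_lie, hx, map_smul]
  lie_mem' hx hy a := by rw [lie_lie, lie_lie, hx, hy, hx, hy, map_sub]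

section Commutant

variable {E : RootVectors H} {T : L →ₗ[ℂ] L} {s : H.root → ℂ} (hT : ∀ h ∈ H, T h = 0)
  (hs : ∀ α : H.root, T (E.vec α.1) = s α • E.vec α.1)

include E in
theorem mem_commutant {x : L} (hH : ∀ h ∈ H, ⁅x, T h⁆ = T ⁅x, h⁆)
    (hE : ∀ β : H.root, ⁅x, T (E.vec β.1)⁆ = T ⁅x, E.vec β.1⁆) : x ∈ commutant T := by
  suffices (ad ℂ L x : L →ₗ[ℂ] L) ∘ₗ T = T ∘ₗ (ad ℂ L x : L →ₗ[ℂ] L) from LinearMap.congr_fun this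
  exact E.hom_ext hH hE

include hT hs

theorem cartan_le_commutant : H ≤ commutant T := by
  refine fun x hx => mem_commutant (E := E) (fun h hh => ?_) fun β => ?_
  · rw [hT h hh, hT _ (H.lie_mem hx hh), lie_zero]
  · have hweight : ⁅x, E.vec β.1⁆ = β.1 ⟨x, hx⟩ • E.vec β.1 := E.lie_cartan β ⟨x, hx⟩
    rw [hs, lie_smul, hweight, map_smul, hs, smul_comm]

theorem vec_mem_commutant {α : H.root} (hα : s α = 0) (hneg : s (-α) = 0)
    (hadd : ∀ β γ : H.root, (rootSystem H).root γ =
      (rootSystem H).root α + (rootSystem H).root β → s γ = s β) : E.vec α.1 ∈ commutant T := by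
  refine mem_commutant (E := E) (fun h hh => ?_) fun β => ?_
  · have hweight : ⁅h, E.vec α.1⁆ = α.1 ⟨h, hh⟩ • E.vec α.1 := E.lie_cartan α ⟨h, hh⟩
    rw [hT h hh, lie_zero, ← lie_skew, hweight, map_neg, map_smul, hs, hα, zero_smul, smul_zero,
      neg_zero]
  rw [hs, lie_smul]
  by_cases hβ : β = -α
  · subst hβ
    have hmem : ⁅E.vec α.1, E.vec (-α : H.root).1⁆ ∈ H := (E.lie_vec_neg α).symm ▸ Subtype.mem _
    rw [hT _ hmem, hneg, zero_smul]
  by_cases hγ : ∃ γ : H.root,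
      (rootSystem H).root γ = (rootSystem H).root α + (rootSystem H).root β
  · obtain ⟨γ, hγ⟩ := hγ
    obtain ⟨c, -, hc⟩ := E.exists_lie_vec_eq_smul hγ
    rw [hc, map_smul, hs, hadd β γ hγ, smul_comm]
  · rw [E.lie_vec_eq_zero hβ (not_exists.1 hγ), smul_zero, map_zero]

end Commutant

section Stabilizer

variable {E : RootVectors H} {Γ : Finset H.root} {lam : Dual ℂ L}
  (b : (rootSystem H).Base) (hlam : coadjointStabilizer lam = levi E Γ)

theorem rootBivector_mem_span_tangent {g : H.root → ℂ} (hg : ∀ α ∈ leviRoots Γ, g α = 0) :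
    rootBivector b E g ∈
      Submodule.span ℂ {w | ∃ x ∈ tangent E Γ, ∃ y ∈ tangent E Γ, w = wedge x y} := by
  refine Submodule.sum_mem _ fun α _ => ?_
  by_cases hα : α ∈ leviRoots Γ
  · rw [hg α hα, zero_smul]
    exact Submodule.zero_mem _
  · exact Submodule.smul_mem _ _ (Submodule.subset_span ⟨_, Submodule.subset_span ⟨α, hα, rfl⟩, _,
      Submodule.subset_span ⟨-α, mt neg_mem_leviRoots_iff.1 hα, rfl⟩, rfl⟩)

include hlam

theorem exists_isGoodEigenvalues_of_isGood (h : IsGood b E Γ lam) :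
    ∃ s, IsGoodEigenvalues (dualFunctional H lam) s := by
  obtain ⟨f, ⟨-, hinv⟩, ⟨K, hK, hself⟩, hkks⟩ := h
  obtain ⟨s, hs⟩ := exists_toEndo_vec_eq_smul (E := E) fun x hx =>
    hinv x (mem_levi_of_mem_cartan hx)
  rw [toM_schouten_self_iff b hlam hs] at hself
  rw [toM_schouten_kks_iff b hlam hs] at hkks
  simp only [← dualFunctional_root_eq_zero_iff hlam] at hself hkks
  refine ⟨fun α => s α / K, fun α => ?_, fun hα hsum => ?_, fun hα hβ hγ hsum => ?_,
    fun hα hβ hγ hsum => ?_⟩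
  · rw [toEndo_eigenvalue_neg hs, neg_div]
  · rw [dualFunctional_root_eq_zero_iff hlam] at hα
    rw [toEndo_eigenvalue_eq_of_add hs hsum (hinv _ (vec_mem_levi hlam hα))]
  · field_simp
    linear_combination hself _ _ _ hα hβ hγ hsum
  · linear_combination K⁻¹ * hkks _ _ _ hα hβ hγ hsum

theorem isGood_of_isGoodEigenvalues {s : H.root → ℂ}
    (hs : IsGoodEigenvalues (dualFunctional H lam) s) (hzero : ∀ α ∈ leviRoots Γ, s α = 0) :
    IsGood b E Γ lam := by
  let f := rootBivector b E fun α => -s α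
  have hf (α : H.root) : toEndo f (E.vec α.1) = s α • E.vec α.1 := by
    rw [toEndo_rootBivector_vec b fun α => by rw [hs.neg], neg_neg]
  have hfH : ∀ h ∈ H, toEndo f h = 0 := fun h hh => toEndo_rootBivector_cartan b _ hh
  have hne {α : H.root} : α ∉ leviRoots Γ → dualFunctional H lam ((rootSystem H).root α) ≠ 0 :=
    mt (dualFunctional_root_eq_zero_iff hlam α).1
  have hinv : levi E Γ ≤ commutant (toEndo f) :=
    levi_le (cartan_le_commutant hfH hf) fun α hα => vec_mem_commutant hfH hf (hzero α hα)
      (hzero _ (neg_mem_leviRoots_iff.2 hα))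
      fun _ _ => hs.eq_of_add ((dualFunctional_root_eq_zero_iff hlam α).2 hα)
  refine ⟨f, ⟨?_, fun x hx => adBivector_eq_zero_iff.2 (hinv hx)⟩, ⟨1, one_ne_zero, ?_⟩, ?_⟩
  · exact rootBivector_mem_span_tangent b fun α hα => by rw [hzero α hα, neg_zero]
  · rw [toM_schouten_self_iff b hlam hf]
    intro α β γ hα hβ hγ hsum
    rw [hs.mul_sum (hne hα) (hne hβ) (hne hγ) hsum, one_pow]
  · rw [toM_schouten_kks_iff b hlam hf]
    exact fun α β γ hα hβ hγ hsum => hs.sq_mul_sum_of_ne_zero (hne hα) (hne hβ) (hne hγ) hsum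

theorem isGood_iff_exists_isQuadraticPair :
    IsGood b E Γ lam ↔ ∃ m, IsQuadraticPair (rootSystem H) (dualFunctional H lam) m := by
  constructor
  · intro h
    obtain ⟨s, hs⟩ := exists_isGoodEigenvalues_of_isGood b hlam h
    exact hs.exists_isQuadraticPair b
  · rintro ⟨m, hm⟩
    refine isGood_of_isGoodEigenvalues b hlam (.of_isQuadraticPair hm) fun α hα => ?_
    rw [hm.1 α ((dualFunctional_root_eq_zero_iff hlam α).2 hα), zero_div]

end Stabilizer

end GoodOrbits

end GoodOrbit

open GoodOrbit LieAlgebra.IsKilling in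
theorem proposition3p5 {L : Type*} [LieRing L] [LieAlgebra ℂ L] [FiniteDimensional ℂ L]
    [LieAlgebra.IsSimple ℂ L] (H : LieSubalgebra ℂ L) [H.IsCartanSubalgebra]
    (b : (rootSystem H).Base) (E : RootVectors H)
    (Γ : Finset H.root) (hΓ : Γ ⊆ b.support)
    (lam : Module.Dual ℂ L) (hlam : coadjointStabilizer lam = levi E Γ) :
    (IsTypeA b → IsGood b E Γ lam) ∧
    (¬ IsTypeA b → Γ ≠ b.support →
      (IsGood b E Γ lam ↔
        (((b.support : Set H.root) \ Γ).ncard = 1 ∨ ((b.support : Set H.root) \ Γ).ncard = 2) ∧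
        ∃ θ : H.root, IsMaximalRoot b θ ∧
          ∀ (i : H.root) (hi : i ∈ b.support), i ∉ Γ →
            b.toWeightBasis.repr ((rootSystem H).root θ) ⟨i, hi⟩ = 1)) ∧
    (IsGood b E Γ lam ↔ ∃ k : ℕ, IsIsoToRootsA (quasiroots Γ) k) := by
  have hker : rootSpan Γ ≤ LinearMap.ker (dualFunctional H lam) :=
    rootSpan_le_ker_dualFunctional hlam
  have hl (α : H.root) : (rootSystem H).root α ∈ rootSpan Γ ↔
      dualFunctional H lam ((rootSystem H).root α) = 0 :=
    (dualFunctional_root_eq_zero_iff hlam α).symm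
  rw [isGood_iff_exists_isQuadraticPair b hlam]
  refine ⟨fun hA => HasCartanMatrixA.exists_isQuadraticPair hA _, fun hA hne => ⟨?_, ?_⟩, ?_, ?_⟩
  · rintro ⟨m, hm⟩
    have hΓ_ssubset : (Γ : Set H.root) ⊂ b.support := Finset.coe_ssubset.2 (hΓ.ssubset_of_ne hne)
    obtain ⟨hcard, θ, hθ, hone⟩ := hm.ncard_diff_and_exists_isHighest hΓ_ssubset hl hA
    exact ⟨hcard, θ, hθ, fun i hi => hone ⟨i, hi⟩⟩
  · rintro ⟨hcard, θ, hθ, hone⟩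
    exact exists_isQuadraticPair_of_ncard_diff
      (fun α hα => hker (Submodule.subset_span ⟨α, hα, rfl⟩)) hcard hθ fun d => hone d.1 d.2
  · rintro ⟨m, hm⟩
    exact hm.exists_isTypeAQuotient b hl
  · rintro ⟨k, hk⟩
    exact IsTypeAQuotient.exists_isQuadraticPair hk hker
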